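/- Let $m\ge 1$, $n\ge 0$, and let $T$ be a finite simple $2$-connected plane graph whose exterior face has length $m+2$, all of whose other faces are triangles, and which has $n$ interior vertices (vertices not on the boundary of the exterior face). Let $T$ be rooted at a directed boundary edge $(v_r,v_y)$ that has the exterior face on its right. A Schnyder wood of $T$ is an orientation of the edges of $T$ and a colouring of them in blue, red and yellow such that: (i) each interior vertex has exactly three outgoing edges, one of each colour, and going anticlockwise around it one sees cyclically: the outgoing blue edge, incoming yellow edges, the outgoing red edge, incoming blue edges, the outgoing yellow edge, incoming red edges (there may be no incoming edges of a given colour); (ii) each boundary vertex other than $v_r,v_y$ has exactly two outgoing edges, one red and one yellow, and going anticlockwise around it starting from the exterior face one sees: incoming yellow edges, the outgoing red edge, incoming blue edges, the outgoing yellow edge, incoming red edges; (iii) $v_r$ has exactly one outgoing edge and $v_y$ has none, all edges directed to $v_r$ are red, and all edges directed to $v_y$ are yellow. A Schnyder wood is maximal if it contains no anticlockwise directed cycle. Consider the maximal Schnyder wood of $T$. For a vertex $v$ and $c\in\{b,r,y\}$ let $P_c(v)$ be the directed path of colour $c$ (blue, red, yellow) that starts at $v$ and continues as long as possible; it may consist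 of $v$ alone. Then for every vertex $v$ of $T$: 1. if $v\notin\{v_r,v_y\}$, every vertex on $P_b(v)$ has an outgoing red edge to a vertex on $P_r(v)$; 2. if $v\ne v_y$, every vertex on $P_r(v)$ has an outgoing yellow edge to a vertex on $P_y(v)$; 3. every vertex on $P_y(v)$ is a boundary vertex of $T$ or has an outgoing blue edge to a vertex on $P_b(v)$. -/

import Mathlib

/-- The three colours of a Schnyder wood. -/
inductive SWColour where
  | blue
  | red
  | yellow

/-- A simple graph drawn in the (oriented) plane or sphere, recorded by its rotation system: `rot d`
is the dart (directed edge) that follows `d` anticlockwise around the tail `d.fst` of `d`.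
The drawing has genus zero by Euler's formula `V - E + F = 2`, stated in `PlaneGraph.IsPlanar`. -/
structure PlaneGraph (V : Type*) where
  graph : SimpleGraph V
  rot : Equiv.Perm graph.Dart
  rot_fst : ∀ d, (rot d).fst = d.fst
  rot_sameCycle : ∀ d d', d.fst = d'.fst → rot.SameCycle d d'

namespace PlaneGraph

variable {V : Type*} (P : PlaneGraph V)

/-- Reversal of darts, as a permutation. -/
def rev : Equiv.Perm P.graph.Dart where
  toFun d := d.symm
  invFun d := d.symm
  left_inv d := d.symm_symm
  right_inv d := d.symm_symm

/-- The dart following `d` on the boundary of the face that lies to the left of `d`: at the head of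
`d`, the dart immediately clockwise of the reversal of `d`. -/
def faceNext : Equiv.Perm P.graph.Dart := P.rev.trans P.rot.symm

/-- The faces are the cycles of `faceNext`. -/
def Face : Type _ := Quotient (Equiv.Perm.SameCycle.setoid P.faceNext)

/-- The face to the left of a dart. The face to the right of `d` is `P.leftFace d.symm`. -/
def leftFace (d : P.graph.Dart) : P.Face :=
  Quotient.mk (Equiv.Perm.SameCycle.setoid P.faceNext) d

/-- The number of (sides of) edges that bound a face. -/
noncomputable def faceLength (f : P.Face) : ℕ := Nat.card {d : P.graph.Dart // P.leftFace d = f}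

/-- Connected and of genus zero. -/
def IsPlanar : Prop :=
  P.graph.Connected ∧ Nat.card V + Nat.card P.Face = Nat.card P.graph.edgeSet + 2

/-- At least three vertices, and connected after the removal of any vertex. -/
def IsTwoConnected : Prop :=
  3 ≤ Nat.card V ∧ P.graph.Connected ∧ ∀ v : V, (P.graph.induce {v}ᶜ).Connected

end PlaneGraph

/-- The rooted simple `2`-connected triangulations of an `(m + 2)`-gon with `n` interior vertices:
the exterior face, which lies to the right of the root edge, has length `m + 2`, and every
other face is a triangle. -/
structure PolygonTriangulation (V : Type*) [Finite V] (n m : ℕ) extends PlaneGraph V where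
  root : graph.Dart
  planar : toPlaneGraph.IsPlanar
  twoConnected : toPlaneGraph.IsTwoConnected
  exterior_length : toPlaneGraph.faceLength (toPlaneGraph.leftFace root.symm) = m + 2
  triangle : ∀ f : toPlaneGraph.Face, f ≠ toPlaneGraph.leftFace root.symm →
    toPlaneGraph.faceLength f = 3
  interior_card : Nat.card {v : V // ¬ ∃ d : graph.Dart,
    toPlaneGraph.leftFace d = toPlaneGraph.leftFace root.symm ∧ d.fst = v} = n

namespace PolygonTriangulation

variable {V : Type*} [Finite V] {n m : ℕ} (T : PolygonTriangulation V n m)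

def exterior : T.Face := T.leftFace T.root.symm

/-- The vertices on the boundary of the exterior face. -/
def IsBoundary (v : V) : Prop := ∃ d : T.graph.Dart, T.leftFace d = T.exterior ∧ d.fst = v

/-- The tail of the root edge. -/
def vr : V := T.root.fst

/-- The head of the root edge. -/
def vy : V := T.root.snd

/-- A closed walk without repetition is anticlockwise if its interior lies on its left: there is a
set of non-exterior faces (those enclosed) such that the darts of the walk are exactly the darts
with a face of the set on the left and a face outside of the set on the right. -/
def IsAnticlockwise {u : V} (p : T.graph.Walk u u) : Prop :=
  p.IsCycle ∧ ∃ A : Set T.Face, T.exterior ∉ A ∧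
    ∀ d : T.graph.Dart, d ∈ p.darts ↔ (T.leftFace d ∈ A ∧ T.leftFace d.symm ∉ A)

/-- An orientation of the edges (`out d` says that the edge of `d` is directed from
`d.fst` to `d.snd`) together with a colouring of the edges. -/
structure ColouredOrientation where
  out : T.graph.Dart → Prop
  out_symm : ∀ d, out d.symm ↔ ¬ out d
  col : T.graph.Dart → SWColour
  col_symm : ∀ d, col d.symm = col d

namespace ColouredOrientation

variable {T} (W : T.ColouredOrientation)

open Classical in
/-- The place of a dart in the anticlockwise pattern around its tail, counted from the outgoing blue
edge: outgoing blue, incoming yellow, outgoing red, incoming blue, outgoing yellow,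
incoming red. -/
noncomputable def rank (d : T.graph.Dart) : ℕ :=
  match W.col d with
  | .blue => if W.out d then 0 else 3
  | .red => if W.out d then 2 else 5
  | .yellow => if W.out d then 4 else 1

/-- The Schnyder condition at an interior vertex: there are exactly three outgoing edges, one of
each colour, and reading anticlockwise from the outgoing blue edge all the way round, one sees the
outgoing blue edge, incoming yellow edges, the outgoing red edge, incoming blue edges,
the outgoing yellow edge, incoming red edges. -/
def SchnyderCondition (v : V) : Prop :=
  (∀ c : SWColour, ∃! d : T.graph.Dart, d.fst = v ∧ W.out d ∧ W.col d = c) ∧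
  ∀ d : T.graph.Dart, d.fst = v → ¬ (W.out (T.rot d) ∧ W.col (T.rot d) = .blue) →
    W.rank d ≤ W.rank (T.rot d)

/-- The Schnyder boundary condition: there are exactly two outgoing edges, a red one and a
yellow one, and reading anticlockwise from the exterior face one sees incoming yellow edges, the
outgoing red edge, incoming blue edges, the outgoing yellow edge, incoming red edges. (The exterior
face lies between `d` and `T.rot d` precisely when it is the face to the left of `d`.) -/
def BoundaryCondition (v : V) : Prop :=
  (∃! d : T.graph.Dart, d.fst = v ∧ W.out d ∧ W.col d = .red) ∧
  (∃! d : T.graph.Dart, d.fst = v ∧ W.out d ∧ W.col d = .yellow) ∧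
  (∀ d : T.graph.Dart, d.fst = v → W.out d → W.col d ≠ .blue) ∧
  ∀ d : T.graph.Dart, d.fst = v → T.leftFace d ≠ T.exterior → W.rank d ≤ W.rank (T.rot d)

/-- The Schnyder root condition, at the two ends of the root edge. -/
def RootCondition : Prop :=
  (∃! d : T.graph.Dart, d.fst = T.vr ∧ W.out d) ∧
  (∀ d : T.graph.Dart, d.fst = T.vy → ¬ W.out d) ∧
  (∀ d : T.graph.Dart, d.snd = T.vr → W.out d → W.col d = .red) ∧
  ∀ d : T.graph.Dart, d.snd = T.vy → W.out d → W.col d = .yellow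

def IsSchnyderWood : Prop :=
  (∀ v, ¬ T.IsBoundary v → W.SchnyderCondition v) ∧
  (∀ v, T.IsBoundary v → v ≠ T.vr → v ≠ T.vy → W.BoundaryCondition v) ∧
  W.RootCondition

/-- A Schnyder wood is maximal if it contains no anticlockwise directed cycle. -/
def IsMaximal : Prop :=
  W.IsSchnyderWood ∧
  ∀ (u : V) (p : T.graph.Walk u u), (∀ d ∈ p.darts, W.out d) → ¬ T.IsAnticlockwise p

/-- There is an edge of colour `c` directed from `x` to `y`. -/
def Edge (c : SWColour) (x y : V) : Prop :=
  ∃ d : T.graph.Dart, d.fst = x ∧ d.snd = y ∧ W.out d ∧ W.col d = c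

/-- The vertex set of the directed path of colour `c` that starts at `v` and continues as long as
possible. As every vertex has at most one outgoing edge of each colour, these are the
vertices that can be reached from `v` along directed edges of colour `c`. -/
def path (c : SWColour) (v : V) : Set V := {w | Relation.ReflTransGen (W.Edge c) v w}

end ColouredOrientation

end PolygonTriangulation

/-! Put an apex in the exterior face, join it to every exterior corner, and direct the new edges to
the apex in blue. The apex, `vr` and `vy` become the roots of colours 0, 1, 2 (blue, red, yellow),
and at every other vertex the local pattern is invariant under cyclic shift of the colours. All
three claims then follow from one statement, `reach_of_edges`: if w → w' has colour c and w' → z has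
colour c + 1, then z lies on the path of colour c + 1 from w. Indeed z ≠ w, since there are no
antiparallel edges, so z lies at or beyond the out-neighbour of w in colour c + 1. If that neighbour
is on the (c + 1)-path from v, so is z; this is the induction step along the c-path from v
(`path_step`).

Planarity enters through rational homology (`Exact`): every closed chain has a potential on the
faces whose jump across an edge, left minus right, is the net flow along it, that is, a winding
number. A path that ends at a root and is never crossed by a jump shows that its corners have the
exterior value (`eq_ext_of_flat`). Two global facts are derived first: a monochromatic path ends at
the root of its colour (`reach_root`), and the edges of colour c together with the reversed edges of
the other colours contain no directed cycle (`Le.antisymm`). In particular, paths of different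
colours from one vertex never meet again.

Maximality also excludes a directed cycle made of one edge of colour c + 1, a path of colour c - 1
and a path of colour c (`no_three_coloured_cycle`): it cannot be anticlockwise, and if it were
clockwise, the (c + 1)-path from the head of its first edge would start inside and could not get
out.

Now suppose that z misses the (c + 1)-path from w. The edge w → w' and the (c + 1)-paths from w and
w' to their common root enclose a region on the left of w → w'. The (c - 1)-path from z starts in
this region and can leave it only at a vertex x of the (c + 1)-path from w. The c-path from x is w →
w' at once if x = w; otherwise it turns back into the region and can leave only through w'. So w' →
z, z to x, x to w' is an excluded cycle. -/

open Relation

/-! ### Rotation systems: darts, faces and sweeps around a vertex -/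

/-- A graph drawn on a closed surface, given by its darts, the tails of the darts, the rotation of
the darts anticlockwise around their tails, and the reversal of darts. -/
structure RotMap (D V : Type*) where
  tail : D → V
  rot : Equiv.Perm D
  rev : D → D
  rev_rev : ∀ d, rev (rev d) = d
  tail_rot : ∀ d, tail (rot d) = tail d
  sameCycle : ∀ d d', tail d = tail d' → rot.SameCycle d d'

namespace RotMap

variable {D V : Type*} (M : RotMap D V)

/-- The head of a dart. -/
def head (d : D) : V := M.tail (M.rev d)

/-- The next dart on the boundary of the face to the left. -/
def next (d : D) : D := M.rot.symm (M.rev d)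

/-- Functions on darts that are functions of the face to the left. -/
def FaceInv {X : Type*} (f : D → X) : Prop := ∀ d, f (M.next d) = f d

/-- One can go from `a` to `b` along a dart of `S`. -/
def Step (S : Set D) (a b : V) : Prop := ∃ d ∈ S, M.tail d = a ∧ M.head d = b

variable {M}

lemma head_rev (d : D) : M.head (M.rev d) = M.tail d := by rw [head, M.rev_rev]

lemma tail_rev (d : D) : M.tail (M.rev d) = M.head d := rfl

lemma tail_rot_symm (d : D) : M.tail (M.rot.symm d) = M.tail d := by
  rw [← M.tail_rot (M.rot.symm d), Equiv.apply_symm_apply]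

lemma tail_next (d : D) : M.tail (M.next d) = M.head d := tail_rot_symm _

lemma FaceInv.rot_symm {X : Type*} {f : D → X} (hf : M.FaceInv f) (x : D) :
    f (M.rot.symm x) = f (M.rev x) := by
  have := hf (M.rev x)
  rwa [next, M.rev_rev] at this

lemma FaceInv.rev_rot {X : Type*} {f : D → X} (hf : M.FaceInv f) (x : D) :
    f (M.rev (M.rot x)) = f x := by
  rw [← hf.rot_symm, Equiv.symm_apply_apply]

lemma FaceInv.iterate {X : Type*} {f : D → X} (hf : M.FaceInv f) (n : ℕ) (x : D) :
    f (M.next^[n] x) = f x := by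
  induction n with
  | zero => rfl
  | succ n ih => rw [Function.iterate_succ_apply', hf, ih]

lemma exists_pow_rot [Finite D] {x y : D} (h : M.tail x = M.tail y) :
    ∃ n : ℕ, (M.rot ^ n) x = y := by
  obtain ⟨n, -, hn⟩ := (M.sameCycle x y h).exists_pow_eq'
  exact ⟨n, hn⟩

/-- Induction around a vertex. The rotation at a vertex is a finite cycle, so propagation in the
anticlockwise sense alone reaches every dart there. -/
lemma forall_of_rot [Finite D] {P : D → Prop} {x y : D} (h : M.tail x = M.tail y) (hx : P x)
    (hP : ∀ z, M.tail z = M.tail x → P (M.rot.symm z) → P z) : P y := by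
  obtain ⟨n, rfl⟩ := exists_pow_rot h
  clear h
  have key : ∀ n : ℕ, M.tail ((M.rot ^ n) x) = M.tail x ∧ P ((M.rot ^ n) x) := by
    intro n
    induction n with
    | zero => exact ⟨rfl, hx⟩
    | succ n ih =>
      rw [pow_succ', Equiv.Perm.mul_apply]
      have ht := (M.tail_rot ((M.rot ^ n) x)).trans ih.1
      exact ⟨ht, hP _ ht (by rw [Equiv.symm_apply_apply]; exact ih.2)⟩
  exact (key n).2

lemma forall_of_rot_symm [Finite D] {P : D → Prop} {x y : D} (h : M.tail x = M.tail y) (hx : P x)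
    (hP : ∀ z, M.tail z = M.tail x → P z → P (M.rot.symm z)) : P y := by
  obtain ⟨n, rfl⟩ := exists_pow_rot h.symm
  clear h
  induction n with
  | zero => exact hx
  | succ n ih =>
    rw [pow_succ', Equiv.Perm.mul_apply] at hx hP
    refine ih ?_ fun z hz => hP z (hz.trans (M.tail_rot _).symm)
    have := hP _ rfl hx
    rwa [Equiv.symm_apply_apply] at this

variable (M) in
/-- The antisymmetric chain of a function on darts. -/
def flow (p : D → ℚ) (d : D) : ℚ := p d - p (M.rev d)

lemma flow_rev (p : D → ℚ) (d : D) : M.flow p (M.rev d) = -M.flow p d := by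
  simp [flow, M.rev_rev]

/-! ### Rational chains and the vanishing of first homology -/

section Chains

variable [Fintype D]

variable (M) in
open Classical in
/-- The net amount that a chain carries out of a vertex. -/
noncomputable def div (g : D → ℚ) (v : V) : ℚ := ∑ d, if M.tail d = v then g d else 0

lemma div_add (g h : D → ℚ) (v : V) : M.div (fun d => g d + h d) v = M.div g v + M.div h v := by
  classical
  simp only [div, ← Finset.sum_add_distrib]
  exact Finset.sum_congr rfl fun d _ => by split_ifs <;> simp

lemma div_sub (g h : D → ℚ) (v : V) : M.div (fun d => g d - h d) v = M.div g v - M.div h v := by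
  classical
  simp only [div, ← Finset.sum_sub_distrib]
  exact Finset.sum_congr rfl fun d _ => by split_ifs <;> simp

lemma div_flow_add (p q : D → ℚ) (v : V) :
    M.div (M.flow fun d => p d + q d) v = M.div (M.flow p) v + M.div (M.flow q) v := by
  rw [← div_add]
  congr 1
  ext d
  simp only [flow]; ring

open Classical in
lemma div_flow_single (e : D) (v : V) :
    M.div (M.flow fun d => if d = e then 1 else 0) v =
      (if v = M.tail e then 1 else 0) - (if v = M.head e then 1 else 0) := by
  have h : ∀ d, M.rev d = e ↔ d = M.rev e := fun d =>
    ⟨fun h => by rw [← h, M.rev_rev], fun h => by rw [h, M.rev_rev]⟩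
  unfold flow
  rw [div_sub]
  simp only [div, h]
  congr 1
  · rw [Finset.sum_eq_single e] <;> simp +contextual [eq_comm]
  · rw [Finset.sum_eq_single (M.rev e)] <;> simp +contextual [eq_comm, head]
    congr

variable (M) in
/-- The first homology of the surface vanishes: every antisymmetric chain without boundary is the
boundary of a combination of faces. -/
def Exact : Prop := ∀ g : D → ℚ, (∀ d, g (M.rev d) = -g d) → (∀ v, M.div g v = 0) →
  ∃ f : D → ℚ, M.FaceInv f ∧ ∀ d, f d - f (M.rev d) = g d

open Classical in
lemma exists_flow {S : Set D} {u v : V} (h : Relation.ReflTransGen (M.Step S) u v) :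
    ∃ p : D → ℚ, (∀ d, 0 ≤ p d) ∧ (∀ d, p d ≠ 0 → d ∈ S) ∧
      ∀ x, M.div (M.flow p) x = (if x = u then 1 else 0) - (if x = v then 1 else 0) := by
  induction h with
  | refl => exact ⟨fun _ => 0, by simp, by simp, by simp [flow, div]⟩
  | tail _ h ih =>
    obtain ⟨p, hp, hS, hd⟩ := ih
    obtain ⟨e, heS, rfl, rfl⟩ := h
    refine ⟨fun d => p d + if d = e then 1 else 0, fun d => ?_, fun d hd => ?_, fun x => ?_⟩
    · have := hp d
      dsimp only
      split_ifs <;> linarith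
    · by_cases h : d = e
      · exact h ▸ heS
      · simp only [h, if_false, add_zero] at hd
        exact hS d hd
    · rw [div_flow_add, hd, div_flow_single]
      ring

/-- The potential of a closed walk that starts with the dart `e`. -/
lemma Exact.exists_potential (hM : M.Exact) {S : Set D} {e : D} (he : e ∈ S)
    (h : Relation.ReflTransGen (M.Step S) (M.head e) (M.tail e)) :
    ∃ p f : D → ℚ, (∀ d, 0 ≤ p d) ∧ (∀ d, p d ≠ 0 → d ∈ S) ∧ 0 < p e ∧ M.FaceInv f ∧
      ∀ d, f d - f (M.rev d) = p d - p (M.rev d) := by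
  classical
  obtain ⟨p, hp, hS, hd⟩ := exists_flow h
  set q : D → ℚ := fun d => p d + if d = e then 1 else 0 with hq
  obtain ⟨f, hf, hfq⟩ := hM (M.flow q) (flow_rev q) fun v => by
    rw [hq, div_flow_add, hd, div_flow_single]; ring
  refine ⟨q, f, fun d => ?_, fun d hd => ?_, ?_, hf, hfq⟩
  · have := hp d
    simp only [hq]
    split_ifs <;> linarith
  · by_cases h : d = e
    · exact h ▸ he
    · simp only [hq, h, if_false, add_zero] at hd
      exact hS d hd
  · have := hp e
    simp only [hq, if_true]
    linarith

/-- Homology vanishes for connected maps of genus zero. -/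
theorem exact_of_euler {F : Type*} [Fintype V] [Fintype F] (out : D → Prop)
    (out_rev : ∀ d, out (M.rev d) ↔ ¬ out d) (face : D → F) (hface : M.FaceInv face)
    (euler : Fintype.card V + Fintype.card F = Nat.card {d // out d} + 2)
    (conn : ∀ h : V → ℚ, (∀ d, h (M.tail d) = h (M.head d)) → ∀ u v, h u = h v)
    (dual : ∀ f : F → ℚ, (∀ d, f (face d) = f (face (M.rev d))) → ∀ a b, f a = f b) :
    M.Exact := by
  classical
  intro g hg hdiv
  let N : Matrix V {d // out d} ℚ := fun v d =>
    (if M.tail d.1 = v then 1 else 0) - (if M.head d.1 = v then 1 else 0)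
  let B : (F → ℚ) →ₗ[ℚ] ({d // out d} → ℚ) :=
    { toFun := fun f d => f (face d.1) - f (face (M.rev d.1))
      map_add' := fun f f' => by ext d; simp only [Pi.add_apply]; ring
      map_smul' := fun c f => by ext d; simp only [Pi.smul_apply, smul_eq_mul, RingHom.id_apply]; ring }
  have hsum : ∀ a : D → ℚ, (∀ d, a (M.rev d) = -a d) → ∀ v,
      (N.mulVec fun d => a d.1) v = M.div a v := by
    intro a ha v
    have e1 : ∑ d : {d // ¬ out d}, (if M.tail d.1 = v then a d.1 else 0) =
        ∑ d : {d // out d}, (if M.head d.1 = v then -a d.1 else 0) := by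
      refine Fintype.sum_equiv
        ⟨fun d => ⟨M.rev d.1, (out_rev _).2 d.2⟩, fun d => ⟨M.rev d.1, fun h => (out_rev _).1 h d.2⟩,
          fun d => Subtype.ext (M.rev_rev _), fun d => Subtype.ext (M.rev_rev _)⟩ _ _ fun d => ?_
      simp only [Equiv.coe_fn_mk, head_rev, ha, neg_neg]
    rw [div, ← Fintype.sum_subtype_add_sum_subtype out, e1, ← Finset.sum_add_distrib]
    refine Finset.sum_congr rfl fun d _ => ?_
    simp only [N]
    split_ifs <;> ring
  have hle : LinearMap.range B ≤ LinearMap.ker N.mulVecLin := by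
    rintro _ ⟨f, rfl⟩
    rw [LinearMap.mem_ker, Matrix.mulVecLin_apply]
    ext v
    have := hsum (fun d => f (face d) - f (face (M.rev d))) (fun d => by rw [M.rev_rev]; ring) v
    simp only [B, LinearMap.coe_mk, AddHom.coe_mk, Pi.zero_apply]
    rw [this, div_sub, div, div, sub_eq_zero]
    have hr : ∀ d, face (M.rev (M.rot d)) = face d := hface.rev_rot
    -- The faces on the right of the darts at `v` are those on their left, shifted by one rotation,
    -- so the two sums cancel.
    rw [← Equiv.sum_comp M.rot (fun d => if M.tail d = v then f (face (M.rev d)) else 0)]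
    simp only [hr, M.tail_rot]
  have hB : Module.finrank ℚ (LinearMap.ker B) ≤ 1 := by
    rcases isEmpty_or_nonempty F with hF | ⟨⟨a⟩⟩
    · rw [Module.finrank_zero_of_subsingleton]; exact Nat.zero_le _
    · refine finrank_le_one ⟨fun _ => 1, by ext; simp [B]⟩ fun w => ⟨w.1 a, ?_⟩
      ext b
      simp only [Submodule.coe_smul, Pi.smul_apply, smul_eq_mul, mul_one]
      refine dual w.1 (fun d => ?_) a b
      have hw : ∀ d : {d // out d}, w.1 (face d.1) - w.1 (face (M.rev d.1)) = 0 := fun d =>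
        congrFun (LinearMap.mem_ker.1 w.2) d
      by_cases hd : out d
      · exact sub_eq_zero.1 (hw ⟨d, hd⟩)
      · have := sub_eq_zero.1 (hw ⟨M.rev d, (out_rev d).2 hd⟩)
        rw [M.rev_rev] at this
        exact this.symm
  have hN : Module.finrank ℚ (LinearMap.ker N.transpose.mulVecLin) ≤ 1 := by
    have key : ∀ w : V → ℚ, ∀ d, (N.transpose.mulVec w) d = w (M.tail d.1) - w (M.head d.1) := by
      intro w d
      have : ∀ v, N v d * w v =
          (if M.tail d.1 = v then w v else 0) - (if M.head d.1 = v then w v else 0) := fun v => by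
        simp only [N, sub_mul, ite_mul, one_mul, zero_mul]
      simp [Matrix.mulVec, dotProduct, this, Finset.sum_sub_distrib]
    rcases isEmpty_or_nonempty V with hV | ⟨⟨a⟩⟩
    · rw [Module.finrank_zero_of_subsingleton]; exact Nat.zero_le _
    · refine finrank_le_one ⟨fun _ => 1, ?_⟩ fun w => ⟨w.1 a, ?_⟩
      · rw [LinearMap.mem_ker, Matrix.mulVecLin_apply]
        ext d
        rw [key]; simp
      · ext b
        simp only [Submodule.coe_smul, Pi.smul_apply, smul_eq_mul, mul_one]
        refine conn w.1 (fun d => ?_) a b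
        have hw : ∀ d : {d // out d}, w.1 (M.tail d.1) - w.1 (M.head d.1) = 0 := fun d => by
          rw [← key]
          exact congrFun (LinearMap.mem_ker.1 w.2) d
        by_cases hd : out d
        · exact sub_eq_zero.1 (hw ⟨d, hd⟩)
        · have := sub_eq_zero.1 (hw ⟨M.rev d, (out_rev d).2 hd⟩)
          rw [tail_rev, head_rev] at this
          exact this.symm
  have r1 := LinearMap.finrank_range_add_finrank_ker B
  have r2 := LinearMap.finrank_range_add_finrank_ker N.mulVecLin
  have r3 := LinearMap.finrank_range_add_finrank_ker N.transpose.mulVecLin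
  have r4 : N.transpose.rank = N.rank := Matrix.rank_transpose N
  rw [Matrix.rank, Matrix.rank] at r4
  rw [Nat.card_eq_fintype_card] at euler
  simp only [Module.finrank_fintype_fun_eq_card] at r1 r2 r3
  -- Connectivity of the graph and of its dual gives rank N ≥ V - 1 and rank B ≥ F - 1. By Euler,
  -- dim ker N ≤ E - V + 1 = F - 1, so the inclusion is an equality.
  have heq : LinearMap.range B = LinearMap.ker N.mulVecLin := by
    refine Submodule.eq_of_le_of_finrank_le hle ?_
    omega
  have hgk : (fun d : {d // out d} => g d.1) ∈ LinearMap.ker N.mulVecLin := by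
    rw [LinearMap.mem_ker, Matrix.mulVecLin_apply]
    ext v
    rw [hsum g hg, hdiv]; rfl
  rw [← heq] at hgk
  obtain ⟨f, hf⟩ := hgk
  have hf' : ∀ d : {d // out d}, f (face d.1) - f (face (M.rev d.1)) = g d.1 := fun d => congrFun hf d
  refine ⟨fun d => f (face d), fun d => by simp only [hface d], fun d => ?_⟩
  by_cases hd : out d
  · exact hf' ⟨d, hd⟩
  · have := hf' ⟨M.rev d, (out_rev d).2 hd⟩
    rw [M.rev_rev, hg] at this
    simp only
    linarith

end Chains

end RotMap

/-- A Schnyder wood, with colours in `ZMod 3`, on a plane map whose exterior face is incident to the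
three roots of the wood. The field `noccw` says that no directed cycle is anticlockwise. -/
structure SchnyderMap (D V : Type*) [Fintype D] extends RotMap D V where
  out : D → Prop
  out_rev : ∀ d, out (rev d) ↔ ¬ out d
  col : D → ZMod 3
  col_rev : ∀ d, col (rev d) = col d
  root : ZMod 3 → V
  ext : D
  exists_ext : ∀ c, ∃ n : ℕ, tail (toRotMap.next^[n] ext) = root c
  exists_out : ∀ v, (∀ k, v ≠ root k) → ∀ c, ∃ d, tail d = v ∧ out d ∧ col d = c
  out_unique : ∀ d d', (∀ k, tail d ≠ root k) → tail d = tail d' → out d → out d' →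
    col d = col d' → d = d'
  rot_out : ∀ d, (∀ k, tail d ≠ root k) → out d →
    (out (rot d) ∧ col (rot d) = col d + 1) ∨ (¬ out (rot d) ∧ col (rot d) = col d - 1)
  rot_in : ∀ d, (∀ k, tail d ≠ root k) → ¬ out d →
    (¬ out (rot d) ∧ col (rot d) = col d) ∨ (out (rot d) ∧ col (rot d) = col d - 1)
  root_col : ∀ d c, (∀ k, tail d ≠ root k) → out d → toRotMap.head d = root c → col d = c
  exact : toRotMap.Exact
  noccw : ∀ A : Set D, (∀ d, toRotMap.next d ∈ A ↔ d ∈ A) → ext ∉ A →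
    (∀ d ∈ A, rev d ∉ A → out d) → A = ∅

/-! ### Schnyder woods with cyclically symmetric colours -/

namespace SchnyderMap

variable {D V : Type*} [Fintype D] (M : SchnyderMap D V)

/-- The edges of colour `c`, apart from those between the roots. -/
def edges (c : ZMod 3) : Set D := {d | M.out d ∧ M.col d = c ∧ ∀ k, M.tail d ≠ M.root k}

/-- `b` is on the path of colour `c` from `a`. -/
def Reach (c : ZMod 3) (a b : V) : Prop := ReflTransGen (M.Step (M.edges c)) a b

/-- The edges of colour `c`, and the reversals of the other edges. -/
def upward (c : ZMod 3) : Set D :=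
  {d | d ∈ M.edges c ∨ M.rev d ∈ M.edges (c + 1) ∨ M.rev d ∈ M.edges (c - 1)}

/-- The order on vertices in which edges of colour `c` go up and the other edges go down. -/
def Le (c : ZMod 3) (a b : V) : Prop := ReflTransGen (M.Step (M.upward c)) a b

variable {M} {c k l : ZMod 3}

lemma Reach.trans {u v w : V} (h : M.Reach c u v) (h' : M.Reach c v w) : M.Reach c u w :=
  ReflTransGen.trans h h'

lemma Le.trans {u v w : V} (h : M.Le c u v) (h' : M.Le c v w) : M.Le c u w :=
  ReflTransGen.trans h h'

lemma not_out_rev {d : D} (h : d ∈ M.edges c) : ¬ M.out (M.rev d) := fun h' =>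
  (M.out_rev d).1 h' h.1

lemma rev_not_mem {d : D} (h : d ∈ M.edges c) : M.rev d ∉ M.edges k := fun h' =>
  not_out_rev h h'.1

lemma col_rev_of_mem {d : D} (h : M.rev d ∈ M.edges c) : M.col d = c := by
  rw [← M.col_rev]; exact h.2.1

lemma edges_unique {d d' : D} (h : d ∈ M.edges c) (h' : d' ∈ M.edges c)
    (ht : M.tail d = M.tail d') : d = d' :=
  M.out_unique d d' h.2.2 ht h.1 h'.1 (h.2.1.trans h'.2.1.symm)

lemma exists_edge {v : V} (hv : ∀ k, v ≠ M.root k) (c : ZMod 3) :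
    ∃ d ∈ M.edges c, M.tail d = v := by
  obtain ⟨d, rfl, h1, h2⟩ := M.exists_out v hv c
  exact ⟨d, ⟨h1, h2, hv⟩, rfl⟩

lemma rot_symm_mem {A : Set D} (hA : ∀ d, M.next d ∈ A ↔ d ∈ A) (x : D) :
    M.rot.symm x ∈ A ↔ M.rev x ∈ A := by
  have := hA (M.rev x)
  rwa [RotMap.next, M.rev_rev] at this

/-! ### The gap between two consecutive outgoing edges -/

section Gap

variable {P : D → Prop} {a b x : D}

/-- Going anticlockwise around a vertex, only incoming edges of colour `c - 1` come between the
outgoing edges of colours `c` and `c + 1`. -/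
lemma pred_cases (hk : k = c - 1) (hl : l = c + 1) (ha : a ∈ M.edges c)
    (hx : M.tail x = M.tail a) (h : (¬ M.out x ∧ M.col x = k) ∨ x ∈ M.edges l) :
    M.rot.symm x = a ∨ (¬ M.out (M.rot.symm x) ∧ M.col (M.rot.symm x) = k) := by
  subst hk hl
  have ht : M.tail (M.rot.symm x) = M.tail a := (RotMap.tail_rot_symm x).trans hx
  have hr : ∀ k, M.tail (M.rot.symm x) ≠ M.root k := ht ▸ ha.2.2
  have key : ∀ m n : ZMod 3, (m - 1 = n - 1 ↔ m = n) ∧ (m - 1 = n + 1 ↔ m = n - 1) ∧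
    (m + 1 = n + 1 ↔ m = n) := by decide
  by_cases ho : M.out (M.rot.symm x)
  · left
    refine edges_unique (c := c) ⟨ho, ?_, hr⟩ ha ht
    have := M.rot_out _ hr ho
    rw [Equiv.apply_symm_apply] at this
    rcases h with h | h
    · rcases this with ⟨h1, -⟩ | ⟨-, h2⟩
      · exact absurd h1 h.1
      · exact (key _ _).1.1 (h2.symm.trans h.2)
    · rcases this with ⟨-, h2⟩ | ⟨h1, -⟩
      · exact (key _ _).2.2.1 (h2.symm.trans h.2.1)
      · exact absurd h.1 h1
  · right
    refine ⟨ho, ?_⟩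
    have := M.rot_in _ hr ho
    rw [Equiv.apply_symm_apply] at this
    rcases h with h | h
    · rcases this with ⟨-, h2⟩ | ⟨h1, -⟩
      · exact h2.symm.trans h.2
      · exact absurd h1 h.1
    · rcases this with ⟨h1, -⟩ | ⟨-, h2⟩
      · exact absurd h.1 h1
      · exact (key _ _).2.1.1 (h2.symm.trans h.2.1)

lemma succ_cases (hk : k = c - 1) (hl : l = c + 1) (hb : b ∈ M.edges l)
    (hx : M.tail x = M.tail b)
    (h : (¬ M.out (M.rot.symm x) ∧ M.col (M.rot.symm x) = k) ∨ M.rot.symm x ∈ M.edges c) :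
    x = b ∨ (¬ M.out x ∧ M.col x = k) := by
  subst hk hl
  have ht : M.tail (M.rot.symm x) = M.tail b := (RotMap.tail_rot_symm x).trans hx
  have hr : ∀ k, M.tail (M.rot.symm x) ≠ M.root k := ht ▸ hb.2.2
  have hrx : ∀ k, M.tail x ≠ M.root k := hx ▸ hb.2.2
  have key : ∀ m : ZMod 3, m - 1 - 1 = m + 1 := by decide
  rcases h with h | h
  · have := M.rot_in _ hr h.1
    rw [Equiv.apply_symm_apply, h.2] at this
    rcases this with h | h
    · exact .inr h
    · exact .inl (edges_unique ⟨h.1, h.2.trans (key c), hrx⟩ hb hx)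
  · have := M.rot_out _ hr h.1
    rw [Equiv.apply_symm_apply, h.2.1] at this
    rcases this with h | h
    · exact .inl (edges_unique ⟨h.1, h.2, hrx⟩ hb hx)
    · exact .inr h

/-- Sweep of the gap from the face on the left of `a` to the face on the right of `b`; the property
has to survive only the incoming edges of the one colour that occurs there. -/
lemma gap_forward (hk : k = c - 1) (hl : l = c + 1) (ha : a ∈ M.edges c) (h0 : P a)
    (hs : ∀ x, M.tail x = M.tail a → ¬ M.out x → M.col x = k → P (M.rot.symm x) → P x) :
    (∀ x, M.tail x = M.tail a → ¬ M.out x → M.col x = k → P x) ∧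
      ∀ b ∈ M.edges l, M.tail b = M.tail a → P (M.rot.symm b) := by
  have key : ∀ x, M.tail a = M.tail x → (¬ M.out x ∧ M.col x = k → P x) := by
    intro x hx
    refine RotMap.forall_of_rot (P := fun x => ¬ M.out x ∧ M.col x = k → P x) hx
      (fun h => absurd ha.1 h.1) fun z hz ih h => ?_
    refine hs z hz h.1 h.2 ?_
    rcases pred_cases hk hl ha hz (.inl h) with h | h
    · rwa [h]
    · exact ih h
  refine ⟨fun x hx h1 h2 => key x hx.symm ⟨h1, h2⟩, fun b hb ht => ?_⟩
  rcases pred_cases hk hl ha ht (.inr hb) with h | h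
  · rwa [h]
  · exact key _ (by rw [RotMap.tail_rot_symm, ht]) h

lemma gap_backward (hk : k = c - 1) (hl : l = c + 1) (hb : b ∈ M.edges l) (h0 : P (M.rot.symm b))
    (hs : ∀ x, M.tail x = M.tail b → ¬ M.out x → M.col x = k → P x → P (M.rot.symm x)) :
    (∀ x, M.tail x = M.tail b → ¬ M.out x → M.col x = k → P x) ∧
      ∀ a ∈ M.edges c, M.tail a = M.tail b → P a := by
  have key : ∀ x, M.tail b = M.tail x → ((¬ M.out x ∧ M.col x = k) ∨ x ∈ M.edges c → P x) := by
    intro x hx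
    refine RotMap.forall_of_rot_symm
      (P := fun x => (¬ M.out x ∧ M.col x = k) ∨ x ∈ M.edges c → P x) hx (fun h => ?_)
      fun z hz ih h => ?_
    · rcases h with h | h
      · exact absurd hb.1 h.1
      · have : ∀ m : ZMod 3, m ≠ m + 1 := by decide
        exact absurd (h.2.1.symm.trans (hb.2.1.trans hl)) (this c)
    · rcases succ_cases hk hl hb hz h with rfl | h
      · exact h0
      · exact hs z hz h.1 h.2 (ih (.inl h))
  exact ⟨fun x hx h1 h2 => key x hx.symm (.inl ⟨h1, h2⟩), fun a ha ht => key a ht.symm (.inr ha)⟩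

variable {f : D → ℚ} (hf : M.FaceInv f)
include hf

/-- A potential that jumps across no incoming edge of the gap is constant on it. The two variants
below allow a jump at a single incoming edge `x` and compare one side of `x` with the nearer end of
the gap. -/
lemma gap_eq (hk : k = c - 1) (hl : l = c + 1) (ha : a ∈ M.edges c) (hb : b ∈ M.edges l)
    (ht : M.tail b = M.tail a)
    (hs : ∀ x, M.tail x = M.tail a → ¬ M.out x → M.col x = k → f x = f (M.rev x)) :
    f a = f (M.rev b) := by
  have := (gap_forward (P := fun x => f a = f x) hk hl ha rfl fun x h1 h2 h3 h4 => by
    rw [hs x h1 h2 h3, ← hf.rot_symm]; exact h4).2 b hb ht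
  rwa [hf.rot_symm] at this

lemma gap_in_forward (hk : k = c - 1) (hl : l = c + 1) (hb : b ∈ M.edges l)
    (ht : M.tail x = M.tail b) (hx : ¬ M.out x) (hxk : M.col x = k)
    (hs : ∀ y, y ≠ x → M.tail y = M.tail b → ¬ M.out y → M.col y = k → f y = f (M.rev y)) :
    f x = f (M.rev b) := by
  by_contra hne
  refine (gap_backward (P := fun y => f x ≠ f y) hk hl hb (by rwa [hf.rot_symm])
    fun y h1 h2 h3 h4 => ?_).1 x ht hx hxk rfl
  rw [hf.rot_symm, ← hs y (by rintro rfl; exact h4 rfl) h1 h2 h3]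
  exact h4

lemma gap_in_backward (hk : k = c - 1) (hl : l = c + 1) (ha : a ∈ M.edges c)
    (ht : M.tail x = M.tail a) (hx : ¬ M.out x) (hxk : M.col x = k)
    (hs : ∀ y, y ≠ x → M.tail y = M.tail a → ¬ M.out y → M.col y = k → f y = f (M.rev y)) :
    f (M.rev x) = f a := by
  by_contra hne
  have key := (gap_forward (P := fun y => f (M.rev x) ≠ f y) hk hl ha hne fun y h1 h2 h3 h4 => by
    rw [hf.rot_symm] at h4
    rw [hs y (by rintro rfl; exact h4 rfl) h1 h2 h3]
    exact h4).1
  rcases pred_cases hk hl ha ht (.inl ⟨hx, hxk⟩) with h | h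
  · rw [← hf.rot_symm, h] at hne
    exact hne rfl
  · refine key _ ((RotMap.tail_rot_symm x).trans ht) h.1 h.2 ?_
    rw [hf.rot_symm]

end Gap

lemma colour_cases (c k : ZMod 3) : k = c ∨ k = c + 1 ∨ k = c - 1 := by
  revert c k; decide

lemma ne_add_one (c : ZMod 3) : c ≠ c + 1 := by revert c; decide

lemma ne_sub_one (c : ZMod 3) : c ≠ c - 1 := by revert c; decide

lemma add_one_ne_sub_one (c : ZMod 3) : c + 1 ≠ c - 1 := by revert c; decide

lemma add_one_add_one (c : ZMod 3) : c - 1 = c + 1 + 1 := by revert c; decide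

lemma sub_one_sub_one (c : ZMod 3) : c + 1 = c - 1 - 1 := by revert c; decide

lemma edges_col_ne {d : D} (h : d ∈ M.edges c) (h' : d ∈ M.edges k) : c = k :=
  h.2.1.symm.trans h'.2.1

/-! ### Regions with monotone boundary trap a coloured path -/

section Trap

variable {A : Set D} (hA : ∀ d, M.next d ∈ A ↔ d ∈ A) (hext : M.ext ∉ A)
include hA

lemma head_closed {h : D} (hh : h ∈ A ∨ M.rev h ∈ A) : ∃ x ∈ A, M.tail x = M.head h := by
  rcases hh with hh | hh
  · exact ⟨_, (hA h).2 hh, RotMap.tail_next h⟩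
  · exact ⟨_, hh, rfl⟩

/-- Suppose both sides of `h` are outside `A`. Sweep away from `h` in both directions as far as the
outgoing edge of colour `c - 1`: by the local pattern and `hb`, every edge met can be crossed only
out of `A`, never into it. Hence no corner at this vertex is in `A`, against `hx`. So a path of
colour `c + 1` that touches `A` keeps touching it. -/
lemma left_trap (hb : ∀ d ∈ A, M.rev d ∉ A → d ∈ M.upward c) {x h : D} (hx : x ∈ A)
    (hh : h ∈ M.edges (c + 1)) (ht : M.tail x = M.tail h) : h ∈ A ∨ M.rev h ∈ A := by
  by_contra hcon
  rw [not_or] at hcon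
  obtain ⟨h1, h2⟩ := hcon
  have cross : ∀ y, ¬ M.out y → M.col y = c → M.rot.symm y ∉ A → y ∉ A := by
    intro y ho hc hr hy
    rw [rot_symm_mem hA] at hr
    rcases hb y hy hr with h | h | h
    · exact ho h.1
    · exact ne_add_one c (hc.symm.trans (col_rev_of_mem h))
    · exact ne_sub_one c (hc.symm.trans (col_rev_of_mem h))
  have cross' : ∀ y k, ¬ M.out y → M.col y = k → k ≠ c → y ∉ A → M.rot.symm y ∉ A := by
    intro y k ho hc hk hr hy
    rw [rot_symm_mem hA] at hy
    rcases hb _ hy (by rwa [M.rev_rev]) with h | h | h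
    · exact hk (hc.symm.trans (col_rev_of_mem h))
    · rw [M.rev_rev] at h; exact ho h.1
    · rw [M.rev_rev] at h; exact ho h.1
  have s1 := gap_forward (P := fun y => y ∉ A) (k := c) (l := c - 1) (by ring)
    (add_one_add_one c) hh h1 fun y _ ho hc hr => cross y ho hc hr
  have s2 := gap_backward (P := fun y => y ∉ A) (c := c) (k := c - 1) rfl rfl hh
    (by rwa [rot_symm_mem hA]) fun y _ ho hc hr => cross' y _ ho hc (ne_sub_one c).symm hr
  obtain ⟨a, ha, hat⟩ := exists_edge hh.2.2 c
  have haA := s2.2 a ha hat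
  have haA' : M.rot.symm a ∉ A := by
    rw [rot_symm_mem hA]
    intro hy
    rcases hb _ hy (by rwa [M.rev_rev]) with h | h | h
    · exact not_out_rev ha h.1
    · rw [M.rev_rev] at h; exact ne_add_one c (edges_col_ne ha h)
    · rw [M.rev_rev] at h; exact ne_sub_one c (edges_col_ne ha h)
  have s3 := gap_backward (P := fun y => y ∉ A) (c := c - 1) (k := c + 1) (l := c)
    (sub_one_sub_one c) (by ring) ha haA'
    fun y _ ho hc hr => cross' y _ ho hc (ne_add_one c).symm hr
  by_cases ho : M.out x
  · have hxr : ∀ k, M.tail x ≠ M.root k := ht ▸ hh.2.2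
    rcases colour_cases c (M.col x) with h | h | h
    · exact s2.2 x ⟨ho, h, hxr⟩ ht hx
    · exact h1 (edges_unique ⟨ho, h, hxr⟩ hh ht ▸ hx)
    · exact s3.2 x ⟨ho, h, hxr⟩ (ht.trans hat.symm) hx
  · rcases colour_cases c (M.col x) with h | h | h
    · exact s1.1 x ht ho h hx
    · exact s3.1 x (ht.trans hat.symm) ho h hx
    · exact s2.1 x ht ho h hx

/-- The mirror image of `left_trap`: with `A` on the right of its boundary, the paths of colour `c -
1` are the trapped ones. -/
lemma right_trap (hb : ∀ d ∉ A, M.rev d ∈ A → d ∈ M.upward c) {x h : D} (hx : x ∈ A)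
    (hh : h ∈ M.edges (c - 1)) (ht : M.tail x = M.tail h) : h ∈ A ∨ M.rev h ∈ A := by
  by_contra hcon
  rw [not_or] at hcon
  obtain ⟨h1, h2⟩ := hcon
  have cross : ∀ y k, ¬ M.out y → M.col y = k → k ≠ c → M.rot.symm y ∉ A → y ∉ A := by
    intro y k ho hc hk hr hy
    rw [rot_symm_mem hA] at hr
    rcases hb _ hr (by rwa [M.rev_rev]) with h | h | h
    · exact hk (hc.symm.trans (col_rev_of_mem h))
    · rw [M.rev_rev] at h; exact ho h.1
    · rw [M.rev_rev] at h; exact ho h.1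
  have cross' : ∀ y, ¬ M.out y → M.col y = c → y ∉ A → M.rot.symm y ∉ A := by
    intro y ho hc hr hy
    rw [rot_symm_mem hA] at hy
    rcases hb _ hr hy with h | h | h
    · exact ho h.1
    · exact ne_add_one c (hc.symm.trans (col_rev_of_mem h))
    · exact ne_sub_one c (hc.symm.trans (col_rev_of_mem h))
  have s1 := gap_forward (P := fun y => y ∉ A) (k := c + 1) (l := c) (sub_one_sub_one c)
    (by ring) hh h1 fun y _ ho hc hr => cross y _ ho hc (ne_add_one c).symm hr
  obtain ⟨a, ha, hat⟩ := exists_edge hh.2.2 c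
  have haA' := s1.2 a ha hat
  have haA : a ∉ A := by
    rw [rot_symm_mem hA] at haA'
    intro hy
    rcases hb _ haA' (by rwa [M.rev_rev]) with h | h | h
    · exact not_out_rev ha h.1
    · rw [M.rev_rev] at h; exact ne_add_one c (edges_col_ne ha h)
    · rw [M.rev_rev] at h; exact ne_sub_one c (edges_col_ne ha h)
  have s2 := gap_forward (P := fun y => y ∉ A) (c := c) (k := c - 1) rfl rfl ha haA
    fun y _ ho hc hr => cross y _ ho hc (ne_sub_one c).symm hr
  have s3 := gap_backward (P := fun y => y ∉ A) (c := c + 1) (k := c) (by ring)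
    (add_one_add_one c) hh (by rwa [rot_symm_mem hA]) fun y _ ho hc hr => cross' y ho hc hr
  by_cases ho : M.out x
  · have hxr : ∀ k, M.tail x ≠ M.root k := ht ▸ hh.2.2
    rcases colour_cases c (M.col x) with h | h | h
    · exact haA (edges_unique ⟨ho, h, hxr⟩ ha (ht.trans hat.symm) ▸ hx)
    · exact s3.2 x ⟨ho, h, hxr⟩ ht hx
    · exact h1 (edges_unique ⟨ho, h, hxr⟩ hh ht ▸ hx)
  · rcases colour_cases c (M.col x) with h | h | h
    · exact s3.1 x ht ho h hx
    · exact s1.1 x ht ho h hx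
    · exact s2.1 x (ht.trans hat.symm) ho h hx

include hext

lemma exists_ext_not_mem (k : ZMod 3) : ∃ y, M.tail y = M.root k ∧ y ∉ A := by
  obtain ⟨n, hn⟩ := M.exists_ext k
  refine ⟨_, hn, ?_⟩
  have h : M.FaceInv fun d => d ∈ A := fun d => propext (hA d)
  rwa [show (_ ∈ A) = (M.ext ∈ A) from h.iterate n M.ext]

/-- A root has an exterior corner, outside `A`. Apart from edges between roots, which are never
upward and so never on the boundary, its edges all come in with the colour of the root. They can
therefore be crossed into `A` in one sense of rotation at most, and a sweep from the exterior corner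
in the other sense never enters `A`. -/
lemma left_not_root (hb : ∀ d ∈ A, M.rev d ∉ A → d ∈ M.upward c) {x : D} (hx : x ∈ A) (k : ZMod 3) :
    M.tail x ≠ M.root k := by
  intro hk
  obtain ⟨y, hy, hyA⟩ := exists_ext_not_mem hA hext k
  by_cases hkc : k = c
  · refine RotMap.forall_of_rot (P := fun z => z ∉ A) (hy.trans hk.symm) hyA (fun z hz hr hzA => ?_) hx
    rw [rot_symm_mem hA] at hr
    have hzk := hz.trans hy
    rcases hb z hzA hr with h | h | h
    · exact h.2.2 k hzk
    · have := M.root_col _ k h.2.2 h.1 (by rw [RotMap.head_rev]; exact hzk)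
      exact ne_add_one c (hkc.symm.trans (this.symm.trans h.2.1))
    · have := M.root_col _ k h.2.2 h.1 (by rw [RotMap.head_rev]; exact hzk)
      exact ne_sub_one c (hkc.symm.trans (this.symm.trans h.2.1))
  · refine RotMap.forall_of_rot_symm (P := fun z => z ∉ A) (hy.trans hk.symm) hyA
      (fun z hz hr hzA => ?_) hx
    rw [rot_symm_mem hA] at hzA
    have hzk := hz.trans hy
    rcases hb _ hzA (by rwa [M.rev_rev]) with h | h | h
    · have := M.root_col _ k h.2.2 h.1 (by rw [RotMap.head_rev]; exact hzk)
      exact hkc (this.symm.trans h.2.1)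
    · rw [M.rev_rev] at h; exact h.2.2 k hzk
    · rw [M.rev_rev] at h; exact h.2.2 k hzk

lemma right_not_root (hb : ∀ d ∉ A, M.rev d ∈ A → d ∈ M.upward c) {x : D} (hx : x ∈ A)
    (k : ZMod 3) : M.tail x ≠ M.root k := by
  intro hk
  obtain ⟨y, hy, hyA⟩ := exists_ext_not_mem hA hext k
  by_cases hkc : k = c
  · refine RotMap.forall_of_rot_symm (P := fun z => z ∉ A) (hy.trans hk.symm) hyA
      (fun z hz hr hzA => ?_) hx
    rw [rot_symm_mem hA] at hzA
    have hzk := hz.trans hy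
    rcases hb z hr hzA with h | h | h
    · exact h.2.2 k hzk
    · have := M.root_col _ k h.2.2 h.1 (by rw [RotMap.head_rev]; exact hzk)
      exact ne_add_one c (hkc.symm.trans (this.symm.trans h.2.1))
    · have := M.root_col _ k h.2.2 h.1 (by rw [RotMap.head_rev]; exact hzk)
      exact ne_sub_one c (hkc.symm.trans (this.symm.trans h.2.1))
  · refine RotMap.forall_of_rot (P := fun z => z ∉ A) (hy.trans hk.symm) hyA
      (fun z hz hr hzA => ?_) hx
    rw [rot_symm_mem hA] at hr
    have hzk := hz.trans hy
    rcases hb _ hr (by rwa [M.rev_rev]) with h | h | h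
    · have := M.root_col _ k h.2.2 h.1 (by rw [RotMap.head_rev]; exact hzk)
      exact hkc (this.symm.trans h.2.1)
    · rw [M.rev_rev] at h; exact h.2.2 k hzk
    · rw [M.rev_rev] at h; exact h.2.2 k hzk

end Trap

end SchnyderMap

namespace SchnyderMap

variable {D V : Type*} [Fintype D] {M : SchnyderMap D V} {c k : ZMod 3}

lemma step_unique {u v w : V} (h : M.Step (M.edges c) u v) (h' : M.Step (M.edges c) u w) :
    v = w := by
  obtain ⟨d, hd, rfl, rfl⟩ := h
  obtain ⟨d', hd', ht, rfl⟩ := h'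
  rw [edges_unique hd' hd ht]

lemma Reach.head_of_ne {u v w : V} (h : M.Reach c u v) (hne : u ≠ v)
    (hs : M.Step (M.edges c) u w) : M.Reach c w v := by
  rcases ReflTransGen.cases_head h with h | ⟨x, hx, h⟩
  · exact absurd h hne
  · rwa [step_unique hs hx]

lemma Reach.comparable {u v w : V} (h : M.Reach c u v) (h' : M.Reach c u w) :
    M.Reach c v w ∨ M.Reach c w v := by
  induction h using ReflTransGen.head_induction_on with
  | refl => exact .inl h'
  | head hs h ih =>
    rcases ReflTransGen.cases_head h' with rfl | ⟨x, hx, h''⟩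
    · exact .inr (ReflTransGen.head hs h)
    · rw [← step_unique hs hx] at h''
      exact ih h''

/-- In a directed chain nothing lies on the left. -/
lemma le_ext {p f : D → ℚ} (hp : ∀ d, 0 ≤ p d) (hS : ∀ d, p d ≠ 0 → M.out d)
    (hf : M.FaceInv f) (hfp : ∀ d, f d - f (M.rev d) = p d - p (M.rev d)) (d : D) :
    f d ≤ f M.ext := by
  by_contra! hlt
  have : Nonempty D := ⟨d⟩
  obtain ⟨m, hm⟩ := Finite.exists_max f
  -- The top level set of `f` has only darts carrying the chain on its boundary, with the set on
  -- their left; such an anticlockwise region is forbidden once the exterior is outside it.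
  have := M.noccw {x | f x = f m} (fun d => by simp only [Set.mem_ofPred_eq, hf d])
    (fun h => by
      have := hm d
      rw [Set.mem_ofPred_eq] at h
      linarith) fun x hx hx' => hS x fun h0 => by
      have h1 := hfp x
      have h2 := hm (M.rev x)
      have h3 := hp (M.rev x)
      rw [Set.mem_ofPred_eq] at hx
      rw [Set.mem_ofPred_eq] at hx'
      apply hx'
      linarith
  have hmem : m ∈ {x | f x = f m} := rfl
  rw [this] at hmem
  exact hmem

lemma eq_empty_of_no_boundary {A : Set D} (hA : ∀ d, M.next d ∈ A ↔ d ∈ A) (hext : M.ext ∉ A)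
    (h : ∀ d ∈ A, M.rev d ∈ A) : A = ∅ :=
  M.noccw A hA hext fun d hd hd' => absurd (h d hd) hd'

/-! ### Monochromatic paths end at their root -/

section Monochromatic

/-- The edges on the path of colour `c` from `u`. -/
def pathEdges (M : SchnyderMap D V) (c : ZMod 3) (u : V) : Set D :=
  {d | d ∈ M.edges c ∧ M.Reach c u (M.tail d)}

/-- The set `A` of faces is bounded by the monochromatic clockwise cycle through `u`. -/
structure IsCycleInterior (M : SchnyderMap D V) (c : ZMod 3) (u : V) (A : Set D) : Prop where
  periodic : TransGen (M.Step (M.edges c)) u u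
  faceInv : ∀ d, M.next d ∈ A ↔ d ∈ A
  ext : M.ext ∉ A
  boundary : ∀ d, (d ∉ A ∧ M.rev d ∈ A) ↔ d ∈ M.pathEdges c u

lemma reach_of_periodic {u v : V} (hu : TransGen (M.Step (M.edges c)) u u) (h : M.Reach c u v) :
    M.Reach c v u := by
  induction h with
  | refl => exact .refl
  | tail _ hs ih =>
    rcases ReflTransGen.cases_head ih with rfl | ⟨x, hx, h⟩
    · obtain ⟨x, hx, h⟩ := TransGen.head'_iff.1 hu
      rwa [step_unique hs hx]
    · rwa [step_unique hs hx]

lemma reach_pathEdges {u v : V} (h : M.Reach c u v) :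
    ReflTransGen (M.Step (M.pathEdges c u)) u v := by
  induction h with
  | refl => exact .refl
  | tail h hs ih =>
    obtain ⟨d, hd, rfl, rfl⟩ := hs
    exact ih.tail ⟨d, ⟨hd, h⟩, rfl, rfl⟩

lemma head_pathEdges {u : V} {d : D} (h : d ∈ M.pathEdges c u) : M.Reach c u (M.head d) :=
  h.2.tail ⟨d, h.1, rfl, rfl⟩

/-- A set of faces whose boundary is part of a monochromatic cycle has the entire cycle as its
boundary. -/
lemma boundary_eq {u : V} {B : Set D} (hu : TransGen (M.Step (M.edges c)) u u)
    (hB : ∀ d, M.next d ∈ B ↔ d ∈ B) (hext : M.ext ∉ B) (hne : B.Nonempty)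
    (hS : ∀ d ∉ B, M.rev d ∈ B → d ∈ M.pathEdges c u) {d : D} (hd : d ∈ M.pathEdges c u) :
    d ∉ B ∧ M.rev d ∈ B := by
  obtain ⟨d0, h0, h0'⟩ : ∃ d ∉ B, M.rev d ∈ B := by
    by_contra! hcon
    refine hne.ne_empty (eq_empty_of_no_boundary hB hext fun d hd => ?_)
    by_contra h
    exact hcon _ h (by rwa [M.rev_rev])
  have key : ∀ v, M.Reach c (M.tail d0) v → ∀ d ∈ M.edges c, M.tail d = v →
      d ∉ B ∧ M.rev d ∈ B := by
    intro v hv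
    induction hv with
    | refl =>
      intro d hd ht
      rw [edges_unique hd (hS d0 h0 h0').1 ht]
      exact ⟨h0, h0'⟩
    | tail _ hs ih =>
      intro d hd ht
      obtain ⟨e, he, ht', rfl⟩ := hs
      obtain ⟨h1, h2⟩ := ih e he ht'
      -- The corners on the two sides of `e` at its head are inside and outside `B`, so an
      -- anticlockwise sweep leaves `B` across some dart there. By `hS` that dart is the unique
      -- outgoing edge of colour `c`.
      obtain ⟨z, hz, hz1, hz2⟩ : ∃ z, M.tail z = M.head e ∧ M.rev z ∈ B ∧ z ∉ B := by
        by_contra! hcon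
        have h : M.rot.symm (M.rev e) ∈ B :=
          RotMap.forall_of_rot (M := M.toRotMap) (P := fun z => z ∈ B) (x := M.rev e)
            (RotMap.tail_rot_symm _).symm h2 fun z hz hr => hcon z hz ((rot_symm_mem hB z).1 hr)
        rw [rot_symm_mem hB, M.rev_rev] at h
        exact h1 h
      have := (hS z hz2 hz1).1
      rw [edges_unique hd this (ht.trans hz.symm)]
      exact ⟨hz2, hz1⟩
  exact key _ ((reach_of_periodic hu (hS d0 h0 h0').2).trans hd.2) d hd.1 rfl

/-- The interior is the lowest level set of the potential of the cycle. By `le_ext` the exterior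
value is the maximum, and the value drops across an edge of the cycle, so the exterior is not in
that set. -/
lemma exists_isCycleInterior {u : V} (hu : TransGen (M.Step (M.edges c)) u u) :
    ∃ A, M.IsCycleInterior c u A := by
  obtain ⟨v, ⟨e, he, rfl, rfl⟩, h⟩ := TransGen.head'_iff.1 hu
  have heS : e ∈ M.pathEdges c (M.tail e) := ⟨he, .refl⟩
  have hback : ReflTransGen (M.Step (M.pathEdges c (M.tail e))) (M.head e) (M.tail e) := by
    have h' : ∀ v, M.Reach c (M.head e) v →
        ReflTransGen (M.Step (M.pathEdges c (M.tail e))) (M.head e) v := by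
      intro v hv
      induction hv with
      | refl => exact .refl
      | tail h hs ih =>
        obtain ⟨d, hd, rfl, rfl⟩ := hs
        exact ih.tail ⟨d, ⟨hd, (head_pathEdges heS).trans h⟩, rfl, rfl⟩
    exact h' _ h
  obtain ⟨p, f, hp, hS, hpe, hf, hfp⟩ := M.exact.exists_potential heS hback
  have hle := le_ext hp (fun d hd => (hS d hd).1.1) hf hfp
  have : Nonempty D := ⟨e⟩
  obtain ⟨m, hm⟩ := Finite.exists_min f
  have hAinv : ∀ d, M.next d ∈ {x | f x = f m} ↔ d ∈ {x | f x = f m} := fun d => by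
    simp only [Set.mem_ofPred_eq, hf d]
  have hpr : p (M.rev e) = 0 := by
    by_contra h
    exact rev_not_mem he (hS _ h).1
  have hextA : M.ext ∉ {x | f x = f m} := fun h => by
    have h1 := hfp e
    have h2 := hle e
    have h3 := hm (M.rev e)
    rw [Set.mem_ofPred_eq] at h
    linarith
  have hb : ∀ d ∉ {x | f x = f m}, M.rev d ∈ {x | f x = f m} → d ∈ M.pathEdges c (M.tail e) := by
    intro d hd hd'
    refine hS d fun h0 => hd ?_
    have h1 := hfp d
    have h2 := hm d
    have h3 := hp (M.rev d)
    rw [Set.mem_ofPred_eq] at hd' ⊢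
    linarith
  exact ⟨_, hu, hAinv, hextA, fun d => ⟨fun h => hb d h.1 h.2,
    fun h => boundary_eq hu hAinv hextA ⟨m, rfl⟩ hb h⟩⟩

/-- Pigeonhole: inside a finite set of vertices that is closed under following the colour, the path
must close up. -/
lemma exists_periodic [Finite V] {C : V → Prop} {u : V} (hu : C u)
    (hC : ∀ v, C v → ∃ w, M.Step (M.edges c) v w ∧ C w) :
    ∃ v, C v ∧ TransGen (M.Step (M.edges c)) v v := by
  classical
  choose! g hg using hC
  have hit : ∀ n, C (g^[n] u) := by
    intro n
    induction n with
    | zero => exact hu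
    | succ n ih => rw [Function.iterate_succ_apply']; exact (hg _ ih).2
  have hR : ∀ n m, TransGen (M.Step (M.edges c)) (g^[n] u) (g^[n + m + 1] u) := by
    intro n m
    induction m with
    | zero => rw [add_zero, Function.iterate_succ_apply']; exact .single (hg _ (hit n)).1
    | succ m ih =>
      refine ih.tail ?_
      rw [← add_assoc, Function.iterate_succ_apply' g (n + m + 1)]
      exact (hg _ (hit _)).1
  obtain ⟨n, m, hne, heq⟩ := Finite.exists_ne_map_eq_of_infinite fun n : ℕ => g^[n] u
  rcases lt_or_gt_of_ne hne with h | h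
  · obtain ⟨r, rfl⟩ := Nat.exists_eq_add_of_lt h
    refine ⟨_, hit n, ?_⟩
    have := hR n r
    rwa [← heq] at this
  · obtain ⟨r, rfl⟩ := Nat.exists_eq_add_of_lt h
    refine ⟨_, hit m, ?_⟩
    have := hR m r
    rwa [heq] at this

/-- Infinite descent. The interior `A` of a clockwise cycle of colour `c` traps the paths of colour
`c - 1` and touches no root, so one of them closes up to a cycle there, whose interior is strictly
smaller. -/
lemma IsCycleInterior.exists_ssubset [Finite V] {u : V} {A : Set D}
    (h : M.IsCycleInterior c u A) :
    ∃ v A', M.IsCycleInterior (c - 1) v A' ∧ A' ⊂ A := by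
  obtain ⟨hu, hA, hext, hbd⟩ := h
  obtain ⟨_, ⟨e, he, rfl, rfl⟩, -⟩ := TransGen.head'_iff.1 hu
  have heS : e ∈ M.pathEdges c (M.tail e) := ⟨he, .refl⟩
  have hb : ∀ d ∉ A, M.rev d ∈ A → d ∈ M.upward c := fun d h1 h2 => .inl ((hbd d).1 ⟨h1, h2⟩).1
  set C : V → Prop := fun v => ∃ x ∈ A, M.tail x = v with hCdef
  have hC : ∀ v, C v → ∃ h ∈ M.edges (c - 1), M.tail h = v ∧ (h ∈ A ∨ M.rev h ∈ A) := by
    rintro _ ⟨x, hx, rfl⟩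
    obtain ⟨h, hh, ht⟩ := exists_edge (right_not_root hA hext hb hx) (c - 1)
    exact ⟨h, hh, ht, right_trap hA hb hx hh ht.symm⟩
  have hC' : ∀ v, C v → ∃ w, M.Step (M.edges (c - 1)) v w ∧ C w := by
    intro v hv
    obtain ⟨h, hh, ht, hhA⟩ := hC v hv
    exact ⟨M.head h, ⟨h, hh, ht, rfl⟩, head_closed hA hhA⟩
  obtain ⟨v, hv, hper⟩ := exists_periodic (C := C)
    ⟨_, ((hbd e).2 heS).2, rfl⟩ hC'
  obtain ⟨A', hA'⟩ := exists_isCycleInterior hper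
  have hCv : ∀ w, M.Reach (c - 1) v w → C w := by
    intro w hw
    induction hw with
    | refl => exact hv
    | tail _ hs ih =>
      obtain ⟨x, hx, hxC⟩ := hC' _ ih
      rwa [step_unique hs hx]
  have hnear : ∀ d ∈ M.pathEdges (c - 1) v, d ∈ A ∨ M.rev d ∈ A := by
    intro d hd
    obtain ⟨h, hh, ht, hhA⟩ := hC _ (hCv _ hd.2)
    rwa [← edges_unique hh hd.1 ht]
  obtain ⟨-, hinv', hext', hbd'⟩ := hA'
  -- Every edge of the new cycle has `A` on at least one side, so the boundary of `A ∪ A'` consists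
  -- of edges of the old cycle; by `boundary_eq` it is all of it, and these edges have no face of `A
  -- ∪ A'` on their left.
  have hdisj : ∀ d ∈ M.pathEdges c (M.tail e), d ∉ A ∪ A' := by
    intro d hd
    refine (boundary_eq hu (B := A ∪ A') (fun d => ?_) ?_ ?_ ?_ hd).1
    · simp only [Set.mem_union, hA, hinv']
    · simp [hext, hext']
    · exact ⟨_, .inl ((hbd e).2 heS).2⟩
    · rintro d hd (hd' | hd')
      · exact (hbd d).1 ⟨fun h => hd (.inl h), hd'⟩
      · by_cases h : M.rev d ∈ A
        · exact (hbd d).1 ⟨fun h => hd (.inl h), h⟩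
        · rcases hnear d ((hbd' d).1 ⟨fun h => hd (.inr h), hd'⟩) with h' | h'
          · exact absurd (Or.inl h') hd
          · exact absurd h' h
  have hsub : A' \ A = ∅ := by
    refine eq_empty_of_no_boundary (M := M) (fun d => ?_) (fun h => hext' h.1) ?_
    · simp only [Set.mem_sdiff, hA, hinv']
    · rintro d ⟨h1, h2⟩
      have h3 : M.rev d ∉ A := fun h3 => hdisj d ((hbd d).1 ⟨h2, h3⟩) (.inr h1)
      refine ⟨?_, h3⟩
      by_contra h4
      rcases hnear _ ((hbd' (M.rev d)).1 ⟨h4, by rwa [M.rev_rev]⟩) with h5 | h5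
      · exact h3 h5
      · rw [M.rev_rev] at h5; exact h2 h5
  refine ⟨v, A', ⟨hper, hinv', hext', hbd'⟩, Set.sdiff_eq_empty.1 hsub, fun hAA' => ?_⟩
  -- Equal interiors would have the same boundary, in two different colours.
  have : A = A' := hAA'.antisymm (Set.sdiff_eq_empty.1 hsub)
  subst this
  have := (hbd' e).1 ((hbd e).2 heS)
  exact ne_sub_one c (edges_col_ne he this.1)

lemma not_isCycleInterior [Finite V] (n : ℕ) : ∀ (c : ZMod 3) (u : V) (A : Set D),
    A.ncard = n → ¬ M.IsCycleInterior c u A := by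
  induction n using Nat.strong_induction_on with
  | _ n ih =>
    intro c u A hn h
    obtain ⟨v, A', h', hs⟩ := h.exists_ssubset
    exact ih _ (hn ▸ Set.ncard_lt_ncard hs) _ _ _ rfl h'

lemma not_periodic [Finite V] (u : V) : ¬ TransGen (M.Step (M.edges c)) u u := fun h => by
  obtain ⟨A, hA⟩ := exists_isCycleInterior h
  exact not_isCycleInterior _ _ _ _ rfl hA

lemma Reach.antisymm [Finite V] {u v : V} (h : M.Reach c u v) (h' : M.Reach c v u) : u = v := by
  rcases ReflTransGen.cases_head h with h | ⟨w, hw, h⟩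
  · exact h
  · exact absurd (TransGen.head' hw (h.trans h')) (not_periodic u)

/-- The path of colour `c` from a vertex other than a root ends at the root of colour `c`. -/
lemma reach_root [Finite V] {u : V} (hu : ∀ k, u ≠ M.root k) (c : ZMod 3) :
    M.Reach c u (M.root c) := by
  obtain ⟨k, hk⟩ : ∃ k, M.Reach c u (M.root k) := by
    by_contra! hcon
    obtain ⟨v, -, hv⟩ := exists_periodic (M := M) (c := c) (C := M.Reach c u) .refl fun v hv => by
      obtain ⟨d, hd, rfl⟩ := exists_edge (M := M) (v := v)
        (fun k hk => hcon k (hk ▸ hv)) c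
      exact ⟨_, ⟨d, hd, rfl, rfl⟩, hv.tail ⟨d, hd, rfl, rfl⟩⟩
    exact not_periodic v hv
  rcases ReflTransGen.cases_tail hk with h | ⟨w, hw, d, hd, rfl, ht⟩
  · exact absurd h.symm (hu k)
  · rwa [← hd.2.1.symm.trans (M.root_col d k hd.2.2 hd.1 ht)] at hk

end Monochromatic

/-! ### The three partial orders on the vertices -/

section Order

variable [Finite V]

omit [Finite V] in
lemma upward_rev_not_mem {d : D} (h : d ∈ M.upward c) : M.rev d ∉ M.upward c := by
  intro h'
  rw [upward, Set.mem_ofPred_eq, M.rev_rev] at h'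
  rcases h with h | h | h <;> rcases h' with h' | h' | h'
  · exact rev_not_mem h h'
  · exact ne_add_one c (edges_col_ne h h')
  · exact ne_sub_one c (edges_col_ne h h')
  · exact ne_add_one c (edges_col_ne h' h)
  · exact rev_not_mem h' h
  · exact rev_not_mem h' h
  · exact ne_sub_one c (edges_col_ne h' h)
  · exact rev_not_mem h' h
  · exact rev_not_mem h' h

/-- A path of colour `c + 1` started in `A` is trapped by `left_trap`, yet it ends at a root, and no
root touches `A`. -/
lemma left_empty {A : Set D} (hA : ∀ d, M.next d ∈ A ↔ d ∈ A) (hext : M.ext ∉ A)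
    (hb : ∀ d ∈ A, M.rev d ∉ A → d ∈ M.upward c) : A = ∅ := by
  by_contra hne
  obtain ⟨x, hx⟩ := Set.nonempty_iff_ne_empty.2 hne
  have key : ∀ v, M.Reach (c + 1) (M.tail x) v → ∃ x ∈ A, M.tail x = v := by
    intro v hv
    induction hv with
    | refl => exact ⟨x, hx, rfl⟩
    | tail _ hs ih =>
      obtain ⟨y, hy, hyt⟩ := ih
      obtain ⟨d, hd, ht, rfl⟩ := hs
      exact head_closed hA (left_trap hA hb hy hd (hyt.trans ht.symm))
  obtain ⟨y, hy, hyt⟩ := key _ (reach_root (left_not_root hA hext hb hx) (c + 1))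
  exact left_not_root hA hext hb hy _ hyt

lemma right_empty {A : Set D} (hA : ∀ d, M.next d ∈ A ↔ d ∈ A) (hext : M.ext ∉ A)
    (hb : ∀ d ∉ A, M.rev d ∈ A → d ∈ M.upward c) : A = ∅ := by
  by_contra hne
  obtain ⟨x, hx⟩ := Set.nonempty_iff_ne_empty.2 hne
  have key : ∀ v, M.Reach (c - 1) (M.tail x) v → ∃ x ∈ A, M.tail x = v := by
    intro v hv
    induction hv with
    | refl => exact ⟨x, hx, rfl⟩
    | tail _ hs ih =>
      obtain ⟨y, hy, hyt⟩ := ih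
      obtain ⟨d, hd, ht, rfl⟩ := hs
      exact head_closed hA (right_trap hA hb hy hd (hyt.trans ht.symm))
  obtain ⟨y, hy, hyt⟩ := key _ (reach_root (right_not_root hA hext hb hx) (c - 1))
  exact right_not_root hA hext hb hy _ hyt

/-- The potential of such a cycle is not constant, so its highest or its lowest level avoids the
exterior. The highest level has its boundary directed upward with the level on the left, the lowest
with the level on the right; both are impossible. -/
lemma not_upward_cycle {e : D} (he : e ∈ M.upward c) : ¬ M.Le c (M.head e) (M.tail e) := by
  intro h
  obtain ⟨p, f, hp, hS, hpe, hf, hfp⟩ := M.exact.exists_potential he h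
  have : Nonempty D := ⟨e⟩
  have hpr : p (M.rev e) = 0 := by
    by_contra h
    exact upward_rev_not_mem he (hS _ h)
  obtain ⟨m, hm⟩ := Finite.exists_max f
  obtain ⟨m', hm'⟩ := Finite.exists_min f
  have hAinv : ∀ (m : D) d, M.next d ∈ {x | f x = f m} ↔ d ∈ {x | f x = f m} := fun m d => by
    simp only [Set.mem_ofPred_eq, hf d]
  by_cases hmax : f M.ext = f m
  · refine Set.notMem_empty m' (right_empty (M := M) (c := c) (hAinv m') (fun h => ?_)
      (fun d hd hd' => hS d fun h0 => hd ?_) ▸ (rfl : m' ∈ {x | f x = f m'}))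
    · have h1 := hfp e
      have h2 := hm e
      have h3 := hm' (M.rev e)
      rw [Set.mem_ofPred_eq] at h
      linarith
    · have h1 := hfp d
      have h2 := hm' d
      have h3 := hp (M.rev d)
      rw [Set.mem_ofPred_eq] at hd' ⊢
      linarith
  · refine Set.notMem_empty m (left_empty (M := M) (c := c) (hAinv m) hmax
      (fun d hd hd' => hS d fun h0 => hd' ?_) ▸ (rfl : m ∈ {x | f x = f m}))
    have h1 := hfp d
    have h2 := hm (M.rev d)
    have h3 := hp (M.rev d)
    rw [Set.mem_ofPred_eq] at hd ⊢
    linarith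

/-- This is the tool that keeps paths apart: together with `Reach.le` and `Reach.ge` it shows that
paths of two colours cannot run between the same two distinct vertices in the same direction, and
that paths of one colour or of two cannot close up. -/
lemma Le.antisymm {u v : V} (h : M.Le c u v) (h' : M.Le c v u) : u = v := by
  rcases ReflTransGen.cases_head h with h | ⟨w, ⟨d, hd, rfl, rfl⟩, h⟩
  · exact h
  · exact absurd (h.trans h') (not_upward_cycle hd)

omit [Finite V] in
lemma Reach.le {u v : V} (h : M.Reach c u v) : M.Le c u v := by
  refine ReflTransGen.mono ?_ _ _ h
  rintro _ _ ⟨d, hd, h⟩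
  exact ⟨d, .inl hd, h⟩

omit [Finite V] in
lemma Reach.ge {u v : V} (h : M.Reach k u v) (hk : k ≠ c) : M.Le c v u := by
  induction h with
  | refl => exact .refl
  | tail _ hs ih =>
    obtain ⟨d, hd, rfl, rfl⟩ := hs
    refine ReflTransGen.head ⟨M.rev d, ?_, rfl, RotMap.head_rev d⟩ ih
    rcases colour_cases c k with rfl | rfl | rfl
    · exact absurd rfl hk
    · exact .inr (.inl (by rwa [M.rev_rev]))
    · exact .inr (.inr (by rwa [M.rev_rev]))

omit [Finite V] in
lemma reach_of_mem {d : D} (h : d ∈ M.edges c) : M.Reach c (M.tail d) (M.head d) :=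
  .single ⟨d, h, rfl, rfl⟩

lemma tail_ne_head {d : D} (h : d ∈ M.edges c) : M.tail d ≠ M.head d := fun he =>
  not_periodic (c := c) (M.tail d) (.single ⟨d, h, rfl, he.symm⟩)

/-- If the potential `f` does not change along the path of colour `c`, then the path runs through
the exterior region of `f`. -/
lemma eq_ext_of_flat {f : D → ℚ} (hf : M.FaceInv f) {v : V}
    (hflat : ∀ x, M.Reach c v (M.tail x) → f x = f (M.rev x)) {x : D} (hx : M.tail x = v) :
    f x = f M.ext := by
  have around : ∀ v, (∀ x, M.Reach c v (M.tail x) → f x = f (M.rev x)) → ∀ x y, M.tail x = v →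
      M.tail y = v → f x = f y := by
    intro v hv x y hx hy
    refine RotMap.forall_of_rot (M := M.toRotMap) (P := fun z => f x = f z) (hx.trans hy.symm) rfl
      fun z hz h => ?_
    rw [hv z (by rw [hz, hx]; exact .refl), ← hf.rot_symm]
    exact h
  have root : ∀ k, (∀ x, M.Reach c (M.root k) (M.tail x) → f x = f (M.rev x)) → ∀ x,
      M.tail x = M.root k → f x = f M.ext := by
    intro k hk x hx
    obtain ⟨n, hn⟩ := M.exists_ext k
    rw [around _ hk x _ hx hn, hf.iterate]
  by_cases hv : ∃ k, v = M.root k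
  · obtain ⟨k, rfl⟩ := hv
    exact root k hflat x hx
  · push Not at hv
    have hr := reach_root hv c
    clear hv
    induction hr using ReflTransGen.head_induction_on generalizing x with
    | refl => exact root c hflat x hx
    | head hs _ ih =>
      obtain ⟨d, hd, rfl, rfl⟩ := hs
      rw [around _ hflat x d hx rfl, hflat d .refl]
      exact ih (fun x hx => hflat x ((reach_of_mem hd).trans hx)) rfl

end Order

end SchnyderMap

/-! ### Three-coloured cycles and the key containment of paths -/

namespace SchnyderMap

variable {D V : Type*} [Fintype D] [Finite V] {M : SchnyderMap D V} {c k : ZMod 3}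

omit [Finite V] in
lemma ne_of_out {x y : D} (hx : M.out x) (hy : ¬ M.out y) : x ≠ y := by
  rintro rfl; exact hy hx

/-- There is no directed cycle that consists of an edge of colour `c + 1`, a path of colour `c - 1`
and a path of colour `c`. -/
lemma no_three_coloured_cycle {e : D} {x : V} (he : e ∈ M.edges (c + 1))
    (h1 : M.Reach (c - 1) (M.head e) x) (h2 : M.Reach c x (M.tail e)) : False := by
  have hxz : x ≠ M.head e := by
    rintro rfl
    exact tail_ne_head he ((h2.ge (ne_sub_one c)).antisymm
      ((reach_of_mem he).ge (add_one_ne_sub_one c)))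
  have hz : ∀ k, M.head e ≠ M.root k := by
    rcases ReflTransGen.cases_head h1 with h | ⟨_, ⟨d, hd, ht, -⟩, -⟩
    · exact absurd h.symm hxz
    · exact ht ▸ hd.2.2
  have hnr : ¬ M.Reach c x (M.head e) := fun h =>
    hxz ((h1.ge (add_one_ne_sub_one c).symm).antisymm (h.ge (ne_add_one c)))
  -- The path of colour `c + 1` from the head of `e` meets the cycle only in its first vertex.
  have hoff : ∀ u, M.Reach (c + 1) (M.head e) u → (M.Reach (c - 1) (M.head e) u ∨ M.Reach c x u) →
      u = M.head e := by
    rintro u hu (h | h)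
    · exact (h.ge (add_one_ne_sub_one c).symm).antisymm hu.le
    · exact ((h.ge (ne_add_one c)).trans (h1.ge (add_one_ne_sub_one c).symm)).antisymm hu.le
  set S : Set D := {d | d = e ∨ d ∈ M.pathEdges (c - 1) (M.head e) ∨ d ∈ M.pathEdges c x} with hSdef
  have hwalk : ReflTransGen (M.Step S) (M.head e) (M.tail e) := by
    refine ReflTransGen.trans (b := x) ?_ ?_
    · refine ReflTransGen.mono ?_ _ _ (reach_pathEdges h1)
      rintro _ _ ⟨d, hd, h⟩
      exact ⟨d, .inr (.inl hd), h⟩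
    · refine ReflTransGen.mono ?_ _ _ (reach_pathEdges h2)
      rintro _ _ ⟨d, hd, h⟩
      exact ⟨d, .inr (.inr hd), h⟩
  obtain ⟨p, f, hp, hS, hpe, hf, hfp⟩ := M.exact.exists_potential (S := S) (.inl rfl) hwalk
  have hSout : ∀ d ∈ S, M.out d := by
    rintro d (rfl | h | h)
    · exact he.1
    · exact h.1.1
    · exact h.1.1
  have hST : ∀ d ∈ S, (M.Reach (c - 1) (M.head e) (M.tail d) ∨ M.Reach c x (M.tail d)) ∧
      (M.Reach (c - 1) (M.head e) (M.head d) ∨ M.Reach c x (M.head d)) := by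
    rintro d (rfl | h | h)
    · exact ⟨.inr h2, .inl .refl⟩
    · exact ⟨.inl h.2, .inl (head_pathEdges h)⟩
    · exact ⟨.inr h.2, .inr (head_pathEdges h)⟩
  have flat : ∀ y, y ∉ S → M.rev y ∉ S → f y = f (M.rev y) := by
    intro y h h'
    have h0 : p y = 0 := by_contra fun h0 => h (hS y h0)
    have h0' : p (M.rev y) = 0 := by_contra fun h0 => h' (hS _ h0)
    have := hfp y
    linarith
  have hin : ∀ y, ¬ M.out y → y ∉ S := fun y hy hyS => hy (hSout y hyS)
  -- Maximality makes the cycle clockwise: the right side of `e` is strictly inside.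
  have hlt : f (M.rev e) < f M.ext := by
    have h1 := le_ext hp (fun d hd => hSout d (hS d hd)) hf hfp e
    have h2 := hfp e
    have h3 : p (M.rev e) = 0 := by_contra fun h0 => hin _ (not_out_rev he) (hS _ h0)
    linarith
  obtain ⟨b, hb, hbt⟩ := exists_edge hz c
  obtain ⟨h, hh, hht⟩ := exists_edge hz (c + 1)
  -- Anticlockwise at the head of `e` come `e`, then `b`, then `h`. From `e` to `h` nothing carries
  -- the chain, so the interior value passes from the right side of `e` to the right side of `h`.
  have e1 : f (M.rev e) = f (M.rev b) := by
    refine gap_in_forward hf (c := c - 1) (sub_one_sub_one c) (by ring) hb hbt.symm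
      (not_out_rev he) ((M.col_rev e).trans he.2.1) fun y hy _ ho hc => flat y (hin y ho) ?_
    rintro (h | h | h)
    · exact hy (by rw [← h, M.rev_rev])
    · exact add_one_ne_sub_one c (hc.symm.trans (col_rev_of_mem h.1))
    · exact ne_add_one c ((col_rev_of_mem h.1).symm.trans hc)
  have e2 : f b = f (M.rev b) := by
    refine flat b ?_ (hin _ (not_out_rev hb))
    rintro (h | h | h)
    · exact tail_ne_head he (h ▸ hbt)
    · exact ne_sub_one c (edges_col_ne hb h.1)
    · exact hnr (hbt ▸ h.2)
  have e3 : f b = f (M.rev h) := by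
    refine gap_eq hf rfl rfl hb hh (hht.trans hbt.symm) fun y ht ho hc => flat y (hin y ho) ?_
    rintro (h | h | h)
    · have h' := he.2.1
      rw [← h, M.col_rev] at h'
      exact add_one_ne_sub_one c (h'.symm.trans hc)
    · have h' := reach_of_mem h.1
      have hd : M.head (M.rev y) = M.head e := by rw [RotMap.head_rev, ht, hbt]
      rw [← hd] at h
      exact tail_ne_head h.1 (h'.antisymm h.2)
    · exact ne_sub_one c ((col_rev_of_mem h.1).symm.trans hc)
  -- Beyond `h` the path of colour `c + 1` is off the cycle and runs to a root, so the right side of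
  -- `h` has the exterior value. This contradicts `hlt`.
  have e4 : f (M.rev h) = f M.ext := by
    have hz' : M.Reach (c + 1) (M.head e) (M.head h) := hht ▸ reach_of_mem hh
    refine eq_ext_of_flat hf (c := c + 1) (v := M.head h) (fun y hy => ?_) rfl
    have hne : ¬ (M.Reach (c - 1) (M.head e) (M.tail y) ∨ M.Reach c x (M.tail y)) := fun h' => by
      have := hoff _ (hz'.trans hy) h'
      rw [this] at hy
      exact tail_ne_head hh (hht.trans (hz'.antisymm hy))
    refine flat y (fun h' => hne (hST y h').1) fun h' => hne ?_
    have := (hST _ h').2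
    rwa [RotMap.head_rev] at this
  linarith

section Merge

open Classical in
/-- The path of colour `c` from `v`, as a chain. -/
noncomputable def pathChain (M : SchnyderMap D V) (c : ZMod 3) (v : V) (d : D) : ℚ :=
  if d ∈ M.pathEdges c v then 1 else 0

open Classical in
-- Prepending an edge to a path adds exactly that edge to the indicator, because a monochromatic
-- path is acyclic and its edges are determined by their tails. The boundaries then telescope.
lemma div_flow_pathChain {v : V} (hv : M.Reach c v (M.root c)) (x : V) :
    M.div (M.flow (M.pathChain c v)) x =
      (if x = v then 1 else 0) - (if x = M.root c then 1 else 0) := by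
  induction hv using ReflTransGen.head_induction_on with
  | refl =>
    have : M.pathChain c (M.root c) = fun _ => 0 := by
      ext d
      rw [pathChain, if_neg]
      rintro ⟨hd, hr⟩
      rcases ReflTransGen.cases_head hr with h | ⟨_, ⟨d', hd', ht, -⟩, -⟩
      · exact hd.2.2 c h.symm
      · exact hd'.2.2 c ht
    rw [this]
    simp [RotMap.flow, RotMap.div]
  | head hs h ih =>
    obtain ⟨o, ho, rfl, rfl⟩ := hs
    have : M.pathChain c (M.tail o) =
        fun d => M.pathChain c (M.head o) d + if d = o then 1 else 0 := by
      ext d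
      by_cases hd : d = o
      · subst hd
        have h1 : d ∈ M.pathEdges c (M.tail d) := ⟨ho, .refl⟩
        have h2 : d ∉ M.pathEdges c (M.head d) := fun h =>
          tail_ne_head ho ((reach_of_mem ho).antisymm h.2)
        simp [pathChain, h1, h2]
      · have : d ∈ M.pathEdges c (M.tail o) ↔ d ∈ M.pathEdges c (M.head o) := by
          refine ⟨fun h => ⟨h.1, ?_⟩, fun h => ⟨h.1, (reach_of_mem ho).trans h.2⟩⟩
          refine h.2.head_of_ne (fun ht => hd (edges_unique h.1 ho ht.symm)) ⟨o, ho, rfl, rfl⟩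
        simp [pathChain, hd, this]
    rw [this, RotMap.div_flow_add, ih, RotMap.div_flow_single]
    ring

omit [Finite V] in
lemma pathChain_eq_zero {v : V} {d : D} (h : d ∉ M.pathEdges c v) : M.pathChain c v d = 0 :=
  if_neg h

/-- The potential of the closed chain formed by an edge of colour `c` and the paths of colour
`c + 1` from its ends. -/
lemma exists_merge_potential {e : D} (he : e ∈ M.edges c) (hw : ∀ k, M.head e ≠ M.root k) :
    ∃ f : D → ℚ, M.FaceInv f ∧ f e = f (M.rev e) + 1 ∧ ∀ d, d ≠ e → M.rev d ≠ e →
      f d - f (M.rev d) =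
        (M.pathChain (c + 1) (M.head e) d - M.pathChain (c + 1) (M.head e) (M.rev d)) -
        (M.pathChain (c + 1) (M.tail e) d - M.pathChain (c + 1) (M.tail e) (M.rev d)) := by
  classical
  have hd1 := div_flow_pathChain (reach_root (M := M) hw (c + 1))
  have hd2 := div_flow_pathChain (reach_root (M := M) he.2.2 (c + 1))
  have hrev : M.rev e ≠ e := (ne_of_out he.1 (not_out_rev he)).symm
  obtain ⟨f, hf, hfg⟩ := M.exact
    (fun d => M.flow (fun d => M.pathChain (c + 1) (M.head e) d + if d = e then 1 else 0) d -
      M.flow (M.pathChain (c + 1) (M.tail e)) d)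
    (fun d => by rw [RotMap.flow_rev, RotMap.flow_rev]; ring)
    (fun v => by
      rw [RotMap.div_sub, RotMap.div_flow_add, RotMap.div_flow_single, hd1, hd2]
      ring)
  refine ⟨f, hf, ?_, fun d h1 h2 => ?_⟩
  · have := hfg e
    have n1 : ∀ v, M.pathChain (c + 1) v e = 0 := fun v =>
      pathChain_eq_zero fun h => ne_add_one c (edges_col_ne he h.1)
    have n2 : ∀ v, M.pathChain (c + 1) v (M.rev e) = 0 := fun v =>
      pathChain_eq_zero fun h => rev_not_mem he h.1
    simp only [RotMap.flow, n1, n2, hrev, if_true, if_false] at this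
    linarith
  · rw [hfg d]
    simp only [RotMap.flow, h1, h2, if_false]
    ring

/-- The tail of an edge of colour `c` has the out-neighbour of colour `c + 1` of the head of the edge
on its path of colour `c + 1`. -/
theorem reach_of_edges {e e' : D} (he : e ∈ M.edges c) (he' : e' ∈ M.edges (c + 1))
    (ht : M.tail e' = M.head e) : M.Reach (c + 1) (M.tail e) (M.head e') := by
  by_contra hnot
  have hw' : ∀ k, M.head e ≠ M.root k := ht ▸ he'.2.2
  -- A root reached by an edge of colour `c + 1` is the root of that colour, where the path from the
  -- tail of `e` ends too; this would contradict `hnot`.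
  have hz : ∀ k, M.head e' ≠ M.root k := by
    intro k hk
    have := M.root_col e' k he'.2.2 he'.1 hk
    rw [he'.2.1] at this
    rw [hk, ← this] at hnot
    exact hnot (reach_root he.2.2 _)
  set w := M.tail e with hwdef
  set w' := M.head e with hwdef'
  set z := M.head e' with hzdef
  have hww' : M.Reach c w w' := reach_of_mem he
  have hwz : M.Reach (c + 1) w' z := ht ▸ reach_of_mem he'
  have hne1 : c + 1 ≠ c := (ne_add_one c).symm
  have hne2 := (add_one_ne_sub_one c).symm
  have hne3 := (ne_sub_one c).symm
  obtain ⟨f, hf, hfe, hfd⟩ := exists_merge_potential he hw'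
  have flat : ∀ y, y ≠ e → M.rev y ≠ e → y ∉ M.pathEdges (c + 1) w' →
      M.rev y ∉ M.pathEdges (c + 1) w' → y ∉ M.pathEdges (c + 1) w →
      M.rev y ∉ M.pathEdges (c + 1) w → f y = f (M.rev y) := by
    intro y h1 h2 h3 h4 h5 h6
    have := hfd y h1 h2
    rw [pathChain_eq_zero h3, pathChain_eq_zero h4, pathChain_eq_zero h5,
      pathChain_eq_zero h6] at this
    linarith
  have flat_in : ∀ y, ¬ M.out y → M.rev y ≠ e → M.rev y ∉ M.pathEdges (c + 1) w' →
      M.rev y ∉ M.pathEdges (c + 1) w → f y = f (M.rev y) := fun y ho h2 h4 h6 =>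
    flat y (ne_of_out he.1 ho).symm h2 (fun h => ho h.1.1) h4 (fun h => ho h.1.1) h6
  have flat_in_col : ∀ y, ¬ M.out y → M.col y ≠ c + 1 → M.rev y ≠ e → f y = f (M.rev y) :=
    fun y ho hc h2 => flat_in y ho h2 (fun h => hc (col_rev_of_mem h.1))
      (fun h => hc (col_rev_of_mem h.1))
  have flat_off : ∀ y, ¬ M.Reach (c + 1) w (M.tail y) → ¬ M.Reach (c + 1) w' (M.tail y) →
      f y = f (M.rev y) := by
    intro y h1 h2
    refine flat y ?_ ?_ (fun h => h2 h.2) (fun h => h2 ?_) (fun h => h1 h.2) (fun h => h1 ?_)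
    · rintro rfl; exact h1 .refl
    · intro h
      rw [hwdef', ← h, RotMap.head_rev] at h2
      exact h2 .refl
    · have := head_pathEdges h; rwa [RotMap.head_rev] at this
    · have := head_pathEdges h; rwa [RotMap.head_rev] at this
  -- the right side of `e` is exterior
  have hre : f (M.rev e) = f M.ext := by
    obtain ⟨h, hh, hht⟩ := exists_edge he.2.2 (c - 1)
    have hwh : M.Reach (c - 1) w (M.head h) := by
      have := reach_of_mem hh
      rwa [hht] at this
    have hflat : ∀ x, M.Reach (c - 1) (M.head h) (M.tail x) → f x = f (M.rev x) := by
      intro x hx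
      have hle : ∀ u, M.Reach (c - 1) (M.head h) u → M.Le (c - 1) u w → False := fun u hu hu' => by
        have huw := hu'.antisymm (hwh.trans hu).le
        rw [huw] at hu
        exact tail_ne_head hh (hht.trans (hwh.antisymm hu))
      exact flat_off x (fun hr => hle _ hx (hr.ge hne2.symm))
        fun hr => hle _ hx ((hr.ge hne2.symm).trans (hww'.ge hne3.symm))
    have e1 : f (M.rev h) = f M.ext := eq_ext_of_flat hf hflat rfl
    have e2 : f (M.rev h) = f h := by rw [hflat _ .refl, M.rev_rev]
    have e3 : f h = f (M.rev e) := by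
      refine gap_eq hf (sub_one_sub_one c) (by ring) hh he hht.symm fun y hyt ho hc => ?_
      have hyw : M.head (M.rev y) = w := by rw [RotMap.head_rev, hyt, hht]
      refine flat_in y ho (fun h => ?_) (fun h => ?_) (fun h => ?_)
      · have := he.2.1
        rw [← h, M.col_rev, hc] at this
        exact hne1 this
      · have := head_pathEdges h
        rw [hyw] at this
        exact tail_ne_head he ((this.ge hne2.symm).antisymm (hww'.ge hne3.symm))
      · have h1 := reach_of_mem h.1
        rw [hyw] at h1
        exact tail_ne_head h.1 ((h.2.antisymm h1) ▸ hyw ▸ rfl)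
    rw [← e3, ← e2, e1]
  have hfe1 : f e = f M.ext + 1 := by rw [hfe, hre]
  -- the left side of the path of colour `c + 1` from `w'`
  have hfe' : f e' = f M.ext + 1 := by
    rw [← hfe1]
    have := gap_in_backward hf (x := M.rev e) (c := c + 1) (k := c) (by ring) rfl he'
      (by rw [ht]; rfl) (not_out_rev he) ((M.col_rev e).trans he.2.1) fun y hy _ ho hc =>
        flat_in_col y ho (fun h => hne1 (h.symm.trans hc)) fun h => hy (by rw [← h, M.rev_rev])
    rw [← this, M.rev_rev]
  obtain ⟨g, hg, hgt⟩ := exists_edge hz (c - 1)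
  have hfg : f g = f M.ext + 1 := by
    rw [← hfe']
    have := gap_in_backward hf (x := M.rev e') (c := c - 1) (k := c + 1) (sub_one_sub_one c) rfl hg
      hgt.symm (not_out_rev he') ((M.col_rev e').trans he'.2.1) fun y hy hyt ho hc => by
        have hyz : M.head (M.rev y) = z := by rw [RotMap.head_rev, hyt, hgt]
        refine flat_in y ho (fun h => ?_) (fun h => ?_) (fun h => hnot ?_)
        · have := he.2.1
          rw [← h, M.col_rev, hc] at this
          exact hne1 this
        · have h1 := reach_of_mem h.1
          by_cases h2 : w' = M.tail (M.rev y)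
          · refine hy ?_
            rw [← edges_unique h.1 he' (h2.symm.trans ht.symm), M.rev_rev]
          · have h3 : M.Reach (c + 1) z (M.tail (M.rev y)) :=
              h.2.head_of_ne h2 ⟨e', he', ht, rfl⟩
            exact tail_ne_head h.1 ((h1.antisymm (hyz ▸ h3)))
        · have := head_pathEdges h
          rwa [hyz] at this
    rw [← this, M.rev_rev]
  have hzg : M.Reach (c - 1) z (M.head g) := hgt ▸ reach_of_mem hg
  -- the path of colour `c - 1` from `z` meets the path of colour `c + 1` from `w`
  obtain ⟨x, hzx, hwx, hxw'⟩ : ∃ x, M.Reach (c - 1) z x ∧ M.Reach (c + 1) w x ∧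
      ¬ M.Reach (c + 1) w' x := by
    have hoff : ∀ u, M.Reach (c - 1) (M.head g) u → ¬ M.Reach (c + 1) w' u := by
      intro u hu hu'
      have hzu : u = z := by
        by_cases h : w' = u
        · rw [← h] at hu ⊢
          exact ((hwz.ge (ne_add_one c).symm).antisymm ((hzg.trans hu).ge hne3)).symm
        · have h' : M.Reach (c + 1) z u := hu'.head_of_ne h ⟨e', he', ht, rfl⟩
          exact (h'.ge hne2.symm).antisymm (hzg.trans hu).le
      rw [hzu] at hu
      exact tail_ne_head hg (hgt.trans (hzg.antisymm hu))
    -- If the two paths did not meet, the path of colour `c - 1` would cross no jump on its way to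
    -- its root, although it starts at value `f M.ext + 1`.
    by_contra! hcon
    have hflat : ∀ y, M.Reach (c - 1) (M.head g) (M.tail y) → f y = f (M.rev y) := fun y hy =>
      flat_off y (fun h => hoff _ hy (hcon _ (hzg.trans hy) h)) (hoff _ hy)
    have e1 : f (M.rev g) = f M.ext := eq_ext_of_flat hf hflat rfl
    have e2 : f (M.rev g) = f g := by rw [hflat _ .refl, M.rev_rev]
    linarith
  -- It remains to find a path of colour `c` from `x` to `w'`; it closes the cycle formed by `e'`
  -- and the path of colour `c - 1` from `z` to `x`.
  refine no_three_coloured_cycle he' hzx ?_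
  rw [ht]
  by_cases hxw : x = w
  · rw [hxw]; exact hww'
  -- the right side of the path of colour `c + 1` from `w`
  have hside : ∀ u, M.Reach (c + 1) w u → ¬ M.Reach (c + 1) w' u →
      (∀ o ∈ M.edges (c + 1), M.tail o = u → f (M.rev o) = f M.ext + 1) ∧
      (u ≠ w → ∀ o ∈ M.edges c, M.tail o = u → f (M.rev o) = f M.ext + 1) := by
    intro u hu
    induction hu with
    | refl =>
      refine fun _ => ⟨fun o ho hot => ?_, fun h => absurd rfl h⟩
      rw [← hfe1]
      refine (gap_eq hf rfl rfl he ho hot fun y _ h1 h2 => flat_in_col y h1 ?_ ?_).symm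
      · exact fun h => hne2 (h2.symm.trans h)
      · intro h
        have := he.2.1
        rw [← h, M.col_rev, h2] at this
        exact hne3 this
    | tail hwu hs ih =>
      intro hnr
      obtain ⟨d, hd, rfl, rfl⟩ := hs
      change M.Reach (c + 1) w (M.tail d) at hwu
      have h0 := (ih fun h => hnr (h.tail ⟨d, hd, rfl, rfl⟩)).1 d hd rfl
      have hstep := reach_of_mem hd
      have hnw : M.head d ≠ w := fun h => by
        rw [h] at hstep
        exact tail_ne_head hd (h ▸ hstep.antisymm hwu)
      have hright : ∀ o ∈ M.edges c, M.tail o = M.head d → f (M.rev o) = f M.ext + 1 := by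
        intro o ho hot
        rw [← h0]
        refine (gap_in_forward hf (c := c - 1) (sub_one_sub_one c) (by ring) ho hot.symm
          (not_out_rev hd) ((M.col_rev d).trans hd.2.1) fun y hy hyt ho hc => ?_).symm
        have hyu : M.head (M.rev y) = M.head d := by rw [RotMap.head_rev, hyt, hot]
        refine flat_in y ho (fun h => ?_) (fun h => hnr ?_) (fun h => ?_)
        · have := he.2.1
          rw [← h, M.col_rev, hc] at this
          exact hne1 this
        · have := head_pathEdges h
          rwa [hyu] at this
        · have hs1 : M.Step (M.edges (c + 1)) (M.tail d) (M.head d) := ⟨d, hd, rfl, rfl⟩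
          have hs2 : M.Step (M.edges (c + 1)) (M.tail (M.rev y)) (M.head d) :=
            ⟨_, h.1, rfl, hyu⟩
          -- Two different edges of one acyclic path cannot enter the same vertex.
          have hcmp : M.tail d = M.tail (M.rev y) := by
            rcases hwu.comparable h.2 with h1 | h1
            · by_contra hne
              exact not_periodic _ (TransGen.tail' (h1.head_of_ne hne hs1) hs2)
            · by_contra hne
              exact not_periodic _ (TransGen.tail' (h1.head_of_ne (Ne.symm hne) hs2) hs1)
          exact hy (by rw [edges_unique hd h.1 hcmp, M.rev_rev])
      refine ⟨fun o ho hot => ?_, fun _ => hright⟩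
      obtain ⟨a, ha, hat⟩ := exists_edge (hot ▸ ho.2.2 : ∀ k, M.head d ≠ M.root k) c
      rw [← hright a ha hat]
      have hfa : f a = f (M.rev a) := by
        refine flat a ?_ (ne_of_out he.1 (not_out_rev ha)).symm
          (fun h => ne_add_one c (edges_col_ne ha h.1)) (fun h => rev_not_mem ha h.1)
          (fun h => ne_add_one c (edges_col_ne ha h.1)) (fun h => rev_not_mem ha h.1)
        rintro rfl
        exact hnw hat.symm
      rw [← hfa]
      refine (gap_eq hf rfl rfl ha ho (hot.trans hat.symm) fun y _ h1 h2 =>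
        flat_in_col y h1 (fun h => hne2 (h2.symm.trans h)) fun h => ?_).symm
      have := he.2.1
      rw [← h, M.col_rev, h2] at this
      exact hne3 this
  have hxr : ∀ k, x ≠ M.root k := by
    intro k hk
    have hk' : k = c + 1 := by
      rcases ReflTransGen.cases_tail hwx with h | ⟨_, _, d, hd, rfl, hdt⟩
      · exact absurd h hxw
      · exact (M.root_col d k hd.2.2 hd.1 (hdt.trans hk)).symm.trans hd.2.1
    rw [hk, hk'] at hxw'
    exact hxw' (reach_root hw' _)
  obtain ⟨a, ha, hat⟩ := exists_edge hxr c
  have hfa := (hside x hwx hxw').2 hxw a ha hat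
  have hxa : M.Reach c x (M.head a) := hat ▸ reach_of_mem ha
  -- Missing `w'`, the path of colour `c` from `x` would avoid both paths of colour `c + 1` after
  -- its first edge and give the exterior value, against `hfa`.
  by_contra hxw''
  have hflat : ∀ y, M.Reach c (M.head a) (M.tail y) → f y = f (M.rev y) := by
    intro y hy
    have hcyc : M.tail y = x → False := fun h => by
      rw [h] at hy
      exact tail_ne_head ha (hat.trans (hxa.antisymm hy))
    have hxy := hxa.trans hy
    refine flat_off y (fun h => hcyc ?_) fun h => ?_
    · rcases hwx.comparable h with h1 | h1
      · exact (h1.ge hne1).antisymm hxy.le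
      · exact (hxy.ge hne3.symm).antisymm (h1.ge hne2.symm)
    · by_cases h' : w' = M.tail y
      · exact hxw'' (h' ▸ hxy)
      · have h2 : M.Reach (c + 1) z (M.tail y) := h.head_of_ne h' ⟨e', he', ht, rfl⟩
        have h3 : M.tail y = z := ((hxy.ge hne1.symm).trans (hzx.ge hne2)).antisymm h2.le
        have h4 : x = z := by
          rw [h3] at hxy
          exact (hzx.ge hne2).antisymm (hxy.ge hne1.symm)
        exact hcyc (h3.trans h4.symm)
  have e1 : f (M.rev a) = f M.ext := eq_ext_of_flat hf hflat rfl
  linarith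

end Merge

end SchnyderMap

/-! ### From regions with directed boundary to simple cycles -/

namespace RotMap

variable {D V : Type*} {M : RotMap D V}

variable (M) in
/-- The darts with a face of `A` on the left and no face of `A` on the right. -/
def boundary (A : Set D) : Set D := {d | d ∈ A ∧ M.rev d ∉ A}

lemma exists_boundary_next [Finite D] {A : Set D} (hA : ∀ d, M.next d ∈ A ↔ d ∈ A) {d : D}
    (hd : d ∈ M.boundary A) : ∃ d' ∈ M.boundary A, M.tail d' = M.head d := by
  by_contra! hcon
  have hr : ∀ x, M.rot.symm x ∈ A ↔ M.rev x ∈ A := fun x => by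
    have := hA (M.rev x)
    rwa [next, M.rev_rev] at this
  have h : M.rot.symm (M.rev d) ∉ A :=
    forall_of_rot (M := M) (P := fun z => z ∉ A) (x := M.rev d) (tail_rot_symm _).symm hd.2
      fun z hz h hzA => hcon z ⟨hzA, fun h' => h ((hr z).2 h')⟩ hz
  rw [hr, M.rev_rev] at h
  exact h hd.1

/-- If the boundary of a set of faces is directed anticlockwise, then so is a simple cycle which is
the boundary of a set of faces. -/
theorem exists_simple_boundary [Fintype D] [Finite V] (hM : M.Exact) {out : D → Prop}
    (hout : ∀ d, out d → ¬ out (M.rev d)) {ext : D}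
    (conn : ∀ A : Set D, (∀ d, M.next d ∈ A ↔ d ∈ A) → ext ∉ A → M.boundary A = ∅ → A = ∅)
    {A : Set D} (hA : ∀ d, M.next d ∈ A ↔ d ∈ A) (hext : ext ∉ A) (hne : A.Nonempty)
    (hb : ∀ d ∈ M.boundary A, out d) :
    ∃ (B : Set D) (s : V → D) (v : V), (∀ d, M.next d ∈ B ↔ d ∈ B) ∧ ext ∉ B ∧
      v ∈ Function.periodicPts (fun x => M.head (s x)) ∧
      (∀ j : ℕ, M.tail (s ((fun x => M.head (s x))^[j] v)) = (fun x => M.head (s x))^[j] v) ∧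
      (∀ d ∈ M.boundary B, out d) ∧
      M.boundary B = Set.range fun j : ℕ => s ((fun x => M.head (s x))^[j] v) := by
  generalize hn : (M.boundary A).ncard = n
  induction n using Nat.strong_induction_on generalizing A with
  | _ n ih =>
    have hbne : (M.boundary A).Nonempty := by
      rw [Set.nonempty_iff_ne_empty]
      exact fun h => hne.ne_empty (conn A hA hext h)
    obtain ⟨d0, hd0⟩ := hbne
    have hD : Nonempty D := ⟨d0⟩
    have hs : ∀ v, ∃ d, (∃ d ∈ M.boundary A, M.tail d = v) → d ∈ M.boundary A ∧ M.tail d = v := by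
      intro v
      by_cases h : ∃ d ∈ M.boundary A, M.tail d = v
      · obtain ⟨d, hd⟩ := h
        exact ⟨d, fun _ => hd⟩
      · exact ⟨d0, fun h' => absurd h' h⟩
    choose s hs using hs
    set g : V → V := fun x => M.head (s x) with hg
    have hgB : ∀ v, (∃ d ∈ M.boundary A, M.tail d = v) → ∃ d ∈ M.boundary A, M.tail d = g v :=
      fun v hv => exists_boundary_next hA (hs v hv).1
    have hit : ∀ j, ∃ d ∈ M.boundary A, M.tail d = g^[j] (M.tail d0) := by
      intro j
      induction j with
      | zero => exact ⟨d0, hd0, rfl⟩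
      | succ j ih => rw [Function.iterate_succ_apply']; exact hgB _ ih
    obtain ⟨v, hvB, hper⟩ : ∃ v, (∃ d ∈ M.boundary A, M.tail d = v) ∧
        v ∈ Function.periodicPts g := by
      obtain ⟨i, j, hij, heq⟩ := Finite.exists_ne_map_eq_of_infinite fun n : ℕ => g^[n] (M.tail d0)
      wlog hlt : i < j generalizing i j
      · exact this j i hij.symm heq.symm (lt_of_le_of_ne (not_lt.1 hlt) hij.symm)
      refine ⟨_, hit i, j - i, by omega, ?_⟩
      rw [Function.IsPeriodicPt, Function.IsFixedPt, ← Function.iterate_add_apply,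
        Nat.sub_add_cancel hlt.le]
      exact heq.symm
    have hitv : ∀ j, ∃ d ∈ M.boundary A, M.tail d = g^[j] v := by
      intro j
      induction j with
      | zero => exact hvB
      | succ j ih => rw [Function.iterate_succ_apply']; exact hgB _ ih
    have htail : ∀ j, M.tail (s (g^[j] v)) = g^[j] v := fun j => (hs _ (hitv j)).2
    set C : Set D := Set.range fun j : ℕ => s (g^[j] v) with hC
    have hCA : C ⊆ M.boundary A := by
      rintro _ ⟨j, rfl⟩
      exact (hs _ (hitv j)).1
    have heC : s v ∈ C := ⟨0, rfl⟩
    have hwalk : ReflTransGen (M.Step C) (M.head (s v)) (M.tail (s v)) := by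
      have h : ∀ j, ReflTransGen (M.Step C) (g v) (g^[j + 1] v) := by
        intro j
        induction j with
        | zero => exact .refl
        | succ j ih =>
          refine ih.tail ⟨s (g^[j + 1] v), ⟨j + 1, rfl⟩, htail _, ?_⟩
          rw [Function.iterate_succ_apply' g (j + 1)]
      obtain ⟨k, hk, hkv⟩ := hper
      obtain ⟨k, rfl⟩ := Nat.exists_eq_succ_of_ne_zero hk.ne'
      have := h k
      rw [show g^[k + 1] v = v from hkv] at this
      rwa [show M.tail (s v) = v from htail 0]
    obtain ⟨p, f, hp, hS, hpe, hf, hfp⟩ := hM.exists_potential heC hwalk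
    have hinv : ∀ r : ℚ, ∀ d, M.next d ∈ {x | f x = r} ↔ d ∈ {x | f x = r} := fun r d => by
      simp only [Set.mem_ofPred_eq, hf d]
    obtain ⟨a, ha⟩ := Finite.exists_max f
    obtain ⟨b, hb'⟩ := Finite.exists_min f
    have hpos : ∀ d, f (M.rev d) < f d → d ∈ C := by
      intro d hd
      refine hS d fun h0 => ?_
      have h1 := hfp d
      have h2 := hp (M.rev d)
      linarith
    -- If the exterior has the top value, the lowest level set is a hole on the right of darts of
    -- `C`. Filling it into `A` removes those darts from the boundary and adds none.
    by_cases hmax : f ext = f a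
    · have hextb : ext ∉ {x | f x = f b} := fun h => by
        have h1 := hfp (s v)
        have h2 := ha (s v)
        have h3 := hb' (M.rev (s v))
        have h4 : p (M.rev (s v)) = 0 := by_contra fun h0 =>
          (hout _ (hb _ (hCA heC))) (hb _ (hCA (hS _ h0)))
        rw [Set.mem_ofPred_eq] at h
        linarith
      have hinvU : ∀ d, M.next d ∈ A ∪ {x | f x = f b} ↔ d ∈ A ∪ {x | f x = f b} := fun d => by
        rw [Set.mem_union, Set.mem_union, hA, hinv]
      have hlow : ∀ d, d ∈ M.boundary {x | f x = f b} → M.rev d ∈ C := by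
        rintro d ⟨h1, h2⟩
        refine hpos _ ?_
        rw [Set.mem_ofPred_eq] at h1 h2
        rw [M.rev_rev, h1]
        exact lt_of_le_of_ne (hb' _) (Ne.symm h2)
      have hsub : M.boundary (A ∪ {x | f x = f b}) ⊆ M.boundary A := by
        rintro d ⟨h1 | h1, h2⟩
        · exact ⟨h1, fun h => h2 (.inl h)⟩
        · exact absurd (.inl (hCA (hlow d ⟨h1, fun h => h2 (.inr h)⟩)).1) h2
      obtain ⟨d, hd⟩ : (M.boundary {x | f x = f b}).Nonempty := by
        rw [Set.nonempty_iff_ne_empty]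
        intro h
        exact Set.notMem_empty b (conn _ (hinv _) hextb h ▸ (rfl : b ∈ {x | f x = f b}))
      have hssub : M.boundary (A ∪ {x | f x = f b}) ⊂ M.boundary A := by
        refine ⟨hsub, fun h => (h (hCA (hlow d hd))).2 ?_⟩
        rw [M.rev_rev]
        exact .inr hd.1
      exact ih _ (hn ▸ Set.ncard_lt_ncard hssub) hinvU
        (by rintro (h | h); exacts [hext h, hextb h])
        (hne.mono Set.subset_union_left) (fun d hd => hb d (hsub hd)) rfl
    · have hsub : M.boundary {x | f x = f a} ⊆ C := by
        rintro d ⟨h1, h2⟩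
        refine hpos d ?_
        rw [Set.mem_ofPred_eq] at h1 h2
        rw [h1]
        exact lt_of_le_of_ne (ha _) h2
      -- Otherwise the top level set lies on the left of darts of `C`. Either its boundary is all of
      -- `C`, or it is a region with strictly fewer boundary darts than `A`.
      by_cases heq : M.boundary A ⊆ M.boundary {x | f x = f a}
      · exact ⟨_, s, v, hinv _, hmax, hper, htail, fun d hd => hb d (hCA (hsub hd)),
          hsub.antisymm (hCA.trans heq)⟩
      · exact ih _ (hn ▸ Set.ncard_lt_ncard ⟨hsub.trans hCA, heq⟩) (hinv _) hmax ⟨a, rfl⟩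
          (fun d hd => hb d (hCA (hsub hd))) rfl

end RotMap

/-! ### Plane graphs as rotation systems of genus zero -/

namespace PlaneGraph

variable {V : Type*} (P : PlaneGraph V)

/-- The darts of a plane graph. -/
def rotMap : RotMap P.graph.Dart V where
  tail d := d.fst
  rot := P.rot
  rev d := d.symm
  rev_rev d := d.symm_symm
  tail_rot := P.rot_fst
  sameCycle := P.rot_sameCycle

lemma rotMap_next (d : P.graph.Dart) : P.rotMap.next d = P.faceNext d := rfl

lemma leftFace_faceNext (d : P.graph.Dart) : P.leftFace (P.faceNext d) = P.leftFace d :=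
  Quotient.sound (s := Equiv.Perm.SameCycle.setoid P.faceNext)
    (Equiv.Perm.sameCycle_apply_left.2 (Equiv.Perm.SameCycle.refl _ _))

lemma leftFace_surjective (F : P.Face) : ∃ d, P.leftFace d = F := Quotient.exists_rep F

lemma sameCycle_of_leftFace_eq {d d' : P.graph.Dart} (h : P.leftFace d = P.leftFace d') :
    P.faceNext.SameCycle d d' := Quotient.exact (s := Equiv.Perm.SameCycle.setoid P.faceNext) h

instance [Finite V] : Finite P.graph.Dart :=
  Finite.of_injective (fun d => d.toProd) fun d d' h => SimpleGraph.Dart.ext d d' h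

instance [Finite V] : Finite P.Face := inferInstanceAs (Finite (Quotient _))

variable {P}

lemma eq_of_leftFace_eq [Finite V] {X : Type*} {f : P.graph.Dart → X} (hf : P.rotMap.FaceInv f)
    {d d' : P.graph.Dart} (h : P.leftFace d = P.leftFace d') : f d = f d' := by
  obtain ⟨n, -, rfl⟩ := (P.sameCycle_of_leftFace_eq h).exists_pow_eq'
  clear h
  induction n with
  | zero => rfl
  | succ n ih => rw [pow_succ', Equiv.Perm.mul_apply, ← rotMap_next, hf]; exact ih

lemma IsPlanar.const_of_adj (hP : P.IsPlanar) {X : Type*} {h : V → X}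
    (hh : ∀ d : P.graph.Dart, h d.fst = h d.snd) (u v : V) : h u = h v := by
  obtain ⟨p⟩ := hP.1.preconnected u v
  induction p with
  | nil => rfl
  | cons ha _ ih => exact (hh ⟨(_, _), ha⟩).trans ih

/-- Connectivity of the dual graph: a function of faces that agrees across every edge is constant
around each vertex, hence along each path of the graph. -/
lemma IsPlanar.const_of_faces [Finite V] (hP : P.IsPlanar) {X : Type*} {f : P.graph.Dart → X}
    (hf : P.rotMap.FaceInv f) (hr : ∀ d, f d = f d.symm) (d d' : P.graph.Dart) : f d = f d' := by
  have around : ∀ x y : P.graph.Dart, x.fst = y.fst → f x = f y := fun x y h =>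
    RotMap.forall_of_rot (M := P.rotMap) (P := fun z => f x = f z) h rfl fun z _ hz => by
      rw [hr z]
      exact hz.trans (hf.rot_symm z)
  have key : ∀ v, (∀ x : P.graph.Dart, x.fst = d.fst → f x = f d) =
      ∀ x : P.graph.Dart, x.fst = v → f x = f d := by
    refine hP.const_of_adj (h := fun v => ∀ x : P.graph.Dart, x.fst = v → f x = f d)
      (fun e => ?_) d.fst
    refine propext ⟨fun h x hx => ?_, fun h x hx => ?_⟩
    · rw [around x e.symm hx, ← hr, h e rfl]
    · rw [around x e hx, hr, h e.symm rfl]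
  exact ((key d'.fst).mp (fun x hx => around x d hx) d' rfl).symm

lemma IsPlanar.boundary_nonempty [Finite V] (hP : P.IsPlanar) {A : Set P.graph.Dart}
    (hA : ∀ d, P.rotMap.next d ∈ A ↔ d ∈ A) {e : P.graph.Dart} (he : e ∉ A)
    (hb : P.rotMap.boundary A = ∅) : A = ∅ := by
  have h : ∀ d ∈ A, d.symm ∈ A := fun d hd => by
    by_contra h'
    exact Set.notMem_empty d (hb ▸ ⟨hd, h'⟩)
  ext d
  have := hP.const_of_faces (f := fun d => d ∈ A) (fun d => propext (hA d))
    (fun d => propext ⟨h d, fun h' => by have := h _ h'; rwa [d.symm_symm] at this⟩) d e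
  rw [this]
  simp [he]

section Orientation

variable {out : P.graph.Dart → Prop} (hout : ∀ d, out d.symm ↔ ¬ out d)
include hout

lemma card_out : Nat.card {d // out d} = Nat.card P.graph.edgeSet := by
  refine Nat.card_congr (Equiv.ofBijective (fun d => ⟨d.1.edge, d.1.edge_mem⟩) ⟨?_, ?_⟩)
  · rintro ⟨d, hd⟩ ⟨d', hd'⟩ h
    rcases SimpleGraph.dart_edge_eq_iff d d' |>.1 (Subtype.ext_iff.1 h) with h | h
    · exact Subtype.ext h
    · rw [h] at hd
      exact absurd hd' ((hout _).1 hd)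
  · rintro ⟨e, he⟩
    induction e with
    | _ a b =>
      let d : P.graph.Dart := ⟨(a, b), he⟩
      by_cases hd : out d
      · exact ⟨⟨d, hd⟩, Subtype.ext rfl⟩
      · exact ⟨⟨d.symm, (hout d).2 hd⟩, Subtype.ext d.edge_symm⟩

lemma card_dart [Finite V] : Nat.card P.graph.Dart = 2 * Nat.card {d // out d} := by
  classical
  have e : {d // ¬ out d} ≃ {d // out d} :=
    ⟨fun d => ⟨d.1.symm, (hout _).2 d.2⟩, fun d => ⟨d.1.symm, fun h => (hout _).1 h d.2⟩,
      fun d => Subtype.ext d.1.symm_symm, fun d => Subtype.ext d.1.symm_symm⟩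
  rw [Nat.card_congr (Equiv.sumCompl out).symm, Nat.card_sum, Nat.card_congr e, two_mul]

lemma IsPlanar.exact [Finite V] [Fintype P.graph.Dart] (hP : P.IsPlanar) : P.rotMap.Exact := by
  have := Fintype.ofFinite V
  have := Fintype.ofFinite P.Face
  refine RotMap.exact_of_euler out hout P.leftFace P.leftFace_faceNext ?_ ?_ ?_
  · rw [card_out hout, ← Nat.card_eq_fintype_card, ← Nat.card_eq_fintype_card]
    exact hP.2
  · exact fun h hh => hP.const_of_adj hh
  · intro f hf a b
    obtain ⟨d, rfl⟩ := P.leftFace_surjective a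
    obtain ⟨d', rfl⟩ := P.leftFace_surjective b
    exact hP.const_of_faces (f := fun d => f (P.leftFace d))
      (fun d => congrArg f (P.leftFace_faceNext d)) hf d d'

end Orientation

end PlaneGraph

namespace PolygonTriangulation

variable {V : Type*} [Finite V] {n m : ℕ} {T : PolygonTriangulation V n m}

lemma isBoundary_vy : T.IsBoundary T.vy := ⟨T.root.symm, rfl, rfl⟩

lemma isBoundary_vr : T.IsBoundary T.vr :=
  ⟨T.faceNext T.root.symm, T.leftFace_faceNext _, T.rotMap.tail_next T.root.symm⟩

lemma vr_ne_vy : T.vr ≠ T.vy := T.root.adj.ne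

namespace ColouredOrientation

variable {W : T.ColouredOrientation}

/-- A set of faces with an anticlockwise directed boundary is empty. -/
theorem IsMaximal.eq_empty (hW : W.IsMaximal) {A : Set T.graph.Dart}
    (hA : ∀ d, T.rotMap.next d ∈ A ↔ d ∈ A) (hext : T.root.symm ∉ A)
    (hb : ∀ d ∈ T.rotMap.boundary A, W.out d) : A = ∅ := by
  by_contra hne
  have := Fintype.ofFinite T.graph.Dart
  obtain ⟨B, s, v, hB, hextB, hper, htail, hbB, hbd⟩ := RotMap.exists_simple_boundary
    (T.planar.exact W.out_symm) (out := W.out) (fun d hd h => (W.out_symm d).1 h hd)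
    (fun A hA h => T.planar.boundary_nonempty hA h) hA hext (Set.nonempty_iff_ne_empty.2 hne) hb
  set g : V → V := fun x => T.rotMap.head (s x) with hg
  have htail' : ∀ j, (s (g^[j] v)).fst = g^[j] v := htail
  have hsnd : ∀ x, (s x).snd = g x := fun x => rfl
  have hsB : ∀ j, s (g^[j] v) ∈ T.rotMap.boundary B := fun j => hbd ▸ ⟨j, rfl⟩
  have hwalk : ∀ k, ∃ p : T.graph.Walk v (g^[k] v),
      p.darts = (List.range k).map fun j => s (g^[j] v) := by
    intro k
    induction k with
    | zero => exact ⟨.nil, rfl⟩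
    | succ k ih =>
      obtain ⟨p, hp⟩ := ih
      have hadj : T.graph.Adj (g^[k] v) (g^[k + 1] v) := by
        have := (s (g^[k] v)).adj
        rwa [htail', hsnd, ← Function.iterate_succ_apply' g] at this
      refine ⟨p.concat hadj, ?_⟩
      rw [SimpleGraph.Walk.darts_concat, hp, List.range_succ, List.map_append, List.concat_eq_append]
      congr 1
      rw [List.map_singleton, List.singleton_inj]
      refine SimpleGraph.Dart.ext _ _ (Prod.ext (htail' k).symm ?_)
      exact Function.iterate_succ_apply' g k v
  -- Stopping at the minimal period makes the vertices of the walk distinct; its edges are distinct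
  -- because no edge is directed both ways.
  set k := Function.minimalPeriod g v with hk
  have hkpos : 0 < k := Function.minimalPeriod_pos_of_mem_periodicPts hper
  have hkv : g^[k] v = v := Function.iterate_minimalPeriod
  obtain ⟨p, hp⟩ := hwalk k
  have hinj : ∀ i < k, ∀ j < k, g^[i] v = g^[j] v → i = j := fun i hi j hj h =>
    Function.iterate_injOn_Iio_minimalPeriod hi hj h
  have hmod : ∀ j, g^[j % k] v = g^[j] v := fun j => Function.iterate_mod_minimalPeriod_eq
  set q : T.graph.Walk v v := p.copy rfl hkv with hq
  have hqd : q.darts = (List.range k).map fun j => s (g^[j] v) := by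
    rw [hq, SimpleGraph.Walk.darts_copy, hp]
  have hqmem : ∀ d, d ∈ q.darts ↔ d ∈ T.rotMap.boundary B := by
    intro d
    rw [hqd, hbd, List.mem_map]
    constructor
    · rintro ⟨j, -, rfl⟩; exact ⟨j, rfl⟩
    · rintro ⟨j, rfl⟩
      exact ⟨j % k, List.mem_range.2 (Nat.mod_lt _ hkpos), by rw [hmod]⟩
  refine hW.2 v q (fun d hd => hbB d ((hqmem d).1 hd)) ⟨?_, ?_⟩
  · rw [SimpleGraph.Walk.isCycle_def]
    refine ⟨⟨?_⟩, ?_, ?_⟩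
    · rw [SimpleGraph.Walk.edges, hqd, List.map_map]
      refine List.Nodup.map_on (fun i hi j hj h => ?_) List.nodup_range
      rcases (SimpleGraph.dart_edge_eq_iff _ _).1 h with h | h
      · change s (g^[i] v) = s (g^[j] v) at h
        refine hinj i (List.mem_range.1 hi) j (List.mem_range.1 hj) ?_
        rw [← htail', h, htail']
      · change s (g^[i] v) = (s (g^[j] v)).symm at h
        have := hbB _ (hsB i)
        rw [h] at this
        exact absurd (hbB _ (hsB j)) ((W.out_symm _).1 this)
    · intro h
      have h' : q.darts = [] := by rw [h]; rfl
      rw [hqd, List.map_eq_nil_iff, List.range_eq_nil] at h'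
      omega
    · rw [← SimpleGraph.Walk.map_snd_darts, hqd, List.map_map]
      refine List.Nodup.map_on (fun i hi j hj h => ?_) List.nodup_range
      simp only [Function.comp_apply, hsnd] at h
      have h' := congrArg (g^[k - 1]) h
      have e : ∀ i, g^[k - 1] (g (g^[i] v)) = g^[i] v := fun i => by
        rw [← Function.iterate_succ_apply' g i, ← Function.iterate_add_apply,
          show k - 1 + (i + 1) = i + k by omega, Function.iterate_add_apply, hkv]
      rw [e, e] at h'
      exact hinj i (List.mem_range.1 hi) j (List.mem_range.1 hj) h'
  · have hface : ∀ d, T.leftFace d ∈ T.leftFace '' B ↔ d ∈ B := by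
      refine fun d => ⟨?_, fun h => ⟨d, h, rfl⟩⟩
      rintro ⟨d', hd', h⟩
      have := PlaneGraph.eq_of_leftFace_eq (P := T.toPlaneGraph) (f := fun d => d ∈ B)
        (fun d => propext (hB d)) h
      rwa [← this]
    refine ⟨T.leftFace '' B, fun h => hextB ((hface _).1 h), fun d => ?_⟩
    rw [hqmem, hface, hface]
    rfl

end ColouredOrientation

end PolygonTriangulation

/-! ### From monotone ranks to rules for consecutive edges -/

/-- The place of an edge in the anticlockwise pattern around a vertex, by its direction and
colour. -/
def patternRank (o : Bool) (c : ZMod 3) : ℕ := if o then 2 * c.val else (2 * c.val + 3) % 6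

set_option synthInstance.maxHeartbeats 200000 in
set_option synthInstance.maxSize 2000 in
-- Monotone ranks alone would permit skipping an outgoing edge. The hypotheses add that the ranks 2
-- and 4 (outgoing red and yellow) are not jumped over, that outgoing blue is reached only from rank
-- at least 4, and that no outgoing colour repeats.
lemma pattern_succ : ∀ (o o' : Bool) (c c' : ZMod 3),
    (o' = true → c' = 0 → 4 ≤ patternRank o c) →
    (¬ (o' = true ∧ c' = 0) → patternRank o c ≤ patternRank o' c' ∧
      (2 ≤ patternRank o c ∨ patternRank o' c' ≤ 2) ∧
      (4 ≤ patternRank o c ∨ patternRank o' c' ≤ 4)) →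
    ¬ (o = true ∧ o' = true ∧ c = c') →
    (o = true ∧ ((o' = true ∧ c' = c + 1) ∨ (o' = false ∧ c' = c - 1))) ∨
    (o = false ∧ ((o' = false ∧ c' = c) ∨ (o' = true ∧ c' = c - 1))) := by
  decide

namespace RotMap

variable {D V : Type*} {M : RotMap D V}

/-- A function on the darts at a vertex that does not decrease anticlockwise, except on arriving at
`b`, increases all the way round from `b`. -/
lemma rot_monotone [Finite D] {rk : D → ℕ} {b : D}
    (hmono : ∀ d, M.tail d = M.tail b → M.rot d ≠ b → rk d ≤ rk (M.rot d)) {d x : D}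
    (hd : M.tail d = M.tail b) (hx : M.tail x = M.tail b) :
    (M.rot d = b → rk x ≤ rk d) ∧ (M.rot d ≠ b → rk x ≤ rk d ∨ rk (M.rot d) ≤ rk x) := by
  set N := Function.minimalPeriod M.rot b with hN
  have hper : b ∈ Function.periodicPts M.rot := by
    refine ⟨orderOf M.rot, orderOf_pos _, ?_⟩
    rw [Function.IsPeriodicPt, Function.IsFixedPt, Equiv.Perm.iterate_eq_pow, pow_orderOf_eq_one]
    rfl
  have hNpos : 0 < N := Function.minimalPeriod_pos_of_mem_periodicPts hper
  have hNb : M.rot^[N] b = b := Function.iterate_minimalPeriod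
  have hinj : ∀ i < N, ∀ j < N, M.rot^[i] b = M.rot^[j] b → i = j := fun i hi j hj h =>
    Function.iterate_injOn_Iio_minimalPeriod hi hj h
  have hex : ∀ y, M.tail y = M.tail b → ∃ i < N, M.rot^[i] b = y := by
    intro y hy
    obtain ⟨i, hi⟩ := exists_pow_rot hy.symm
    rw [← Equiv.Perm.iterate_eq_pow] at hi
    refine ⟨i % N, Nat.mod_lt _ hNpos, ?_⟩
    rw [Function.iterate_mod_minimalPeriod_eq, hi]
  have htail : ∀ i, M.tail (M.rot^[i] b) = M.tail b := by
    intro i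
    induction i with
    | zero => rfl
    | succ i ih => rw [Function.iterate_succ_apply', M.tail_rot, ih]
  have hne : ∀ i, i + 1 < N → M.rot^[i + 1] b ≠ b := fun i hi h => by
    have := hinj (i + 1) hi 0 hNpos h
    omega
  have hm : ∀ j i, i ≤ j → j < N → rk (M.rot^[i] b) ≤ rk (M.rot^[j] b) := by
    intro j
    induction j with
    | zero => intro i hi _; rw [Nat.le_zero.1 hi]
    | succ j ih =>
      intro i hi hj
      rcases Nat.lt_or_ge j i with h | h
      · rw [show i = j + 1 by omega]
      · refine (ih i h (by omega)).trans ?_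
        rw [Function.iterate_succ_apply']
        refine hmono _ (htail j) ?_
        rw [← Function.iterate_succ_apply' M.rot]
        exact hne j hj
  obtain ⟨i, hi, rfl⟩ := hex d hd
  obtain ⟨j, hj, rfl⟩ := hex x hx
  rw [← Function.iterate_succ_apply' M.rot]
  refine ⟨fun h => hm i j ?_ hi, fun h => ?_⟩
  · by_contra hlt
    exact hne i (by omega) h
  · rcases Nat.lt_or_ge i j with h' | h'
    · exact .inr (hm j (i + 1) h' hj)
    · exact .inl (hm i j h' hi)

open Classical in
/-- The rules for the succession of edges around a vertex that obeys the Schnyder condition. -/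
lemma succ_of_monotone [Finite D] {out : D → Prop} {col : D → ZMod 3} {u : V}
    (hex : ∀ c, ∃ d, M.tail d = u ∧ out d ∧ col d = c)
    (huniq : ∀ d d', M.tail d = u → M.tail d' = u → out d → out d' → col d = col d' → d = d')
    (hmono : ∀ d, M.tail d = u → ¬ (out (M.rot d) ∧ col (M.rot d) = 0) →
      patternRank (decide (out d)) (col d) ≤ patternRank (decide (out (M.rot d))) (col (M.rot d)))
    {d : D} (hd : M.tail d = u) :
    (out d ∧ ((out (M.rot d) ∧ col (M.rot d) = col d + 1) ∨
      (¬ out (M.rot d) ∧ col (M.rot d) = col d - 1))) ∨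
    (¬ out d ∧ ((¬ out (M.rot d) ∧ col (M.rot d) = col d) ∨
      (out (M.rot d) ∧ col (M.rot d) = col d - 1))) := by
  obtain ⟨b, hb, hbo, hbc⟩ := hex 0
  obtain ⟨x, hx, hxo, hxc⟩ := hex 1
  obtain ⟨y, hy, hyo, hyc⟩ := hex 2
  set rk : D → ℕ := fun d => patternRank (decide (out d)) (col d) with hrk
  -- Outgoing red and outgoing yellow do occur at `u`, with ranks 2 and 4; by `rot_monotone` no step
  -- can therefore pass over these ranks.
  have hrx : rk x = 2 := by simp only [hrk, hxo, hxc]; decide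
  have hry : rk y = 4 := by simp only [hrk, hyo, hyc]; decide
  have htr : M.tail (M.rot d) = u := (M.tail_rot d).trans hd
  have hmono' : ∀ d, M.tail d = M.tail b → M.rot d ≠ b → rk d ≤ rk (M.rot d) := fun d hd h =>
    hmono d (hd.trans hb) fun h' => h (huniq _ _ ((M.tail_rot d).trans (hd.trans hb)) hb h'.1 hbo
      (h'.2.trans hbc.symm))
  have kx := rot_monotone hmono' (hd.trans hb.symm) (hx.trans hb.symm)
  have ky := rot_monotone hmono' (hd.trans hb.symm) (hy.trans hb.symm)
  rw [hrx] at kx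
  rw [hry] at ky
  have := pattern_succ (decide (out d)) (decide (out (M.rot d))) (col d) (col (M.rot d))
    (fun h1 h2 => ky.1 (huniq _ _ htr hb (of_decide_eq_true h1) hbo (h2.trans hbc.symm)))
    (fun h => ?_) (fun h => ?_)
  · simpa only [decide_eq_true_eq, decide_eq_false_iff_not] using this
  · rw [decide_eq_true_eq] at h
    have hne : M.rot d ≠ b := fun h' => h (h' ▸ ⟨hbo, hbc⟩)
    exact ⟨hmono d hd h, kx.2 hne, ky.2 hne⟩
  -- A repeated outgoing colour would make `d` a fixed point of the rotation, hence the only dart at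
  -- `u`, whereas both red and yellow leave `u`.
  · rw [decide_eq_true_eq, decide_eq_true_eq] at h
    have hdd := huniq _ _ hd htr h.1 h.2.1 h.2.2
    have hall : ∀ z, M.tail z = u → d = z := fun z hz =>
      forall_of_rot (M := M) (P := fun z => d = z) (hd.trans hz.symm) rfl fun z _ h => by
        rw [hdd, h, Equiv.apply_symm_apply]
    have hxy := (hall x hx).symm.trans (hall y hy)
    rw [hxy, hyc] at hxc
    exact absurd hxc (by decide)

end RotMap

/-- The colours as residues modulo three. -/
def SWColour.code : SWColour → ZMod 3
  | .blue => 0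
  | .red => 1
  | .yellow => 2

lemma SWColour.code_injective : Function.Injective SWColour.code := by
  rintro (_ | _ | _) (_ | _ | _) h <;> first | rfl | exact absurd h (by decide)

lemma SWColour.code_surjective : Function.Surjective SWColour.code := by
  have : ∀ k : ZMod 3, k = 0 ∨ k = 1 ∨ k = 2 := by decide
  intro k
  rcases this k with rfl | rfl | rfl
  exacts [⟨.blue, rfl⟩, ⟨.red, rfl⟩, ⟨.yellow, rfl⟩]

/-! ### Out-degrees and the exterior boundary -/

namespace PolygonTriangulation

variable {V : Type*} [Finite V] {n m : ℕ} {T : PolygonTriangulation V n m}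
  {W : T.ColouredOrientation}

namespace ColouredOrientation

open Classical in
lemma rank_eq (d : T.graph.Dart) :
    W.rank d = patternRank (decide (W.out d)) (W.col d).code := by
  rw [rank]
  cases W.col d <;> by_cases h : W.out d <;> simp only [h, if_true, if_false] <;> decide

lemma IsSchnyderWood.root_yellow (hW : W.IsSchnyderWood) :
    W.out T.root ∧ W.col T.root = .yellow := by
  have h : W.out T.root := by
    by_contra h
    exact hW.2.2.2.1 T.root.symm rfl ((W.out_symm _).2 h)
  exact ⟨h, hW.2.2.2.2.2 _ rfl h⟩

variable (W) in
lemma outdegree_interior {v : V} (h : W.SchnyderCondition v) :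
    Nat.card {x : {d // W.out d} // x.1.fst = v} = 3 := by
  refine (Nat.card_congr (Equiv.ofBijective (fun x => (W.col x.1.1).code) ⟨?_, ?_⟩)).trans
    (Nat.card_zmod 3)
  · rintro ⟨⟨d, hd⟩, ht⟩ ⟨⟨d', hd'⟩, ht'⟩ hc
    obtain ⟨e, -, he⟩ := h.1 (W.col d)
    have := (he d ⟨ht, hd, rfl⟩).trans
      (he d' ⟨ht', hd', (SWColour.code_injective hc).symm⟩).symm
    exact Subtype.ext (Subtype.ext this)
  · intro k
    obtain ⟨c, rfl⟩ := SWColour.code_surjective k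
    obtain ⟨e, ⟨h1, h2, h3⟩, -⟩ := h.1 c
    exact ⟨⟨⟨e, h2⟩, h1⟩, congrArg _ h3⟩

lemma BoundaryCondition.unique {v : V} (h : W.BoundaryCondition v) {d d' : T.graph.Dart}
    (ht : d.fst = v) (ht' : d'.fst = v) (hd : W.out d) (hd' : W.out d') (hc : W.col d = W.col d') :
    d = d' := by
  obtain ⟨⟨r, -, hr⟩, ⟨y, -, hy⟩, hb, -⟩ := h
  cases hcol : W.col d with
  | blue => exact absurd hcol (hb d ht hd)
  | red => exact (hr d ⟨ht, hd, hcol⟩).trans (hr d' ⟨ht', hd', hc.symm.trans hcol⟩).symm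
  | yellow => exact (hy d ⟨ht, hd, hcol⟩).trans (hy d' ⟨ht', hd', hc.symm.trans hcol⟩).symm

variable (W) in
lemma outdegree_boundary {v : V} (h : W.BoundaryCondition v) :
    Nat.card {x : {d // W.out d} // x.1.fst = v} = 2 := by
  refine (Nat.card_congr (β := {k : ZMod 3 // k ≠ 0}) (Equiv.ofBijective
    (fun x => ⟨(W.col x.1.1).code, fun h0 => ?_⟩) ⟨?_, ?_⟩)).trans ?_
  · exact h.2.2.1 x.1.1 x.2 x.1.2 (SWColour.code_injective (h0.trans rfl))
  · rintro ⟨⟨d, hd⟩, ht⟩ ⟨⟨d', hd'⟩, ht'⟩ hc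
    exact Subtype.ext (Subtype.ext (h.unique ht ht' hd hd'
      (SWColour.code_injective (Subtype.ext_iff.1 hc))))
  · rintro ⟨k, hk⟩
    obtain ⟨c, rfl⟩ := SWColour.code_surjective k
    cases c with
    | blue => exact absurd rfl hk
    | red =>
      obtain ⟨e, ⟨h1, h2, h3⟩, -⟩ := h.1
      exact ⟨⟨⟨e, h2⟩, h1⟩, Subtype.ext (congrArg SWColour.code h3)⟩
    | yellow =>
      obtain ⟨e, ⟨h1, h2, h3⟩, -⟩ := h.2.1
      exact ⟨⟨⟨e, h2⟩, h1⟩, Subtype.ext (congrArg SWColour.code h3)⟩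
  · rw [Nat.card_eq_fintype_card]; decide

/-- The exterior face is incident to every boundary vertex exactly once. -/
theorem IsSchnyderWood.exterior_unique (hW : W.IsSchnyderWood) {d d' : T.graph.Dart}
    (hd : T.leftFace d = T.exterior) (hd' : T.leftFace d' = T.exterior) (ht : d.fst = d'.fst) :
    d = d' := by
  classical
  have := Fintype.ofFinite V
  have := Fintype.ofFinite T.Face
  -- Out-degree falls short of 3 by one at each boundary vertex, by one more at `vr` and by two more
  -- at `vy`.
  have hdeg : ∀ v, Nat.card {x : {d // W.out d} // x.1.fst = v} + (if v = T.vr then 1 else 0) +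
      (if v = T.vy then 2 else 0) + (if T.IsBoundary v then 1 else 0) = 3 := by
    intro v
    by_cases hr : v = T.vr
    · subst hr
      have : Nat.card {x : {d // W.out d} // x.1.fst = T.vr} = 1 := by
        rw [Nat.card_eq_one_iff_exists]
        obtain ⟨e, ⟨h1, h2⟩, h3⟩ := hW.2.2.1
        exact ⟨⟨⟨e, h2⟩, h1⟩, fun x => Subtype.ext (Subtype.ext (h3 _ ⟨x.2, x.1.2⟩))⟩
      rw [this]
      simp [T.isBoundary_vr, T.vr_ne_vy]
    · by_cases hy : v = T.vy
      · subst hy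
        have : Nat.card {x : {d // W.out d} // x.1.fst = T.vy} = 0 := by
          rw [Nat.card_eq_zero]
          exact .inl ⟨fun x => hW.2.2.2.1 _ x.2 x.1.2⟩
        rw [this]
        simp [T.isBoundary_vy, hr]
      · by_cases hb : T.IsBoundary v
        · rw [W.outdegree_boundary (hW.2.1 v hb hr hy)]
          simp [hr, hy, hb]
        · rw [W.outdegree_interior (hW.1 v hb)]
          simp [hr, hy, hb]
  have hsum : Nat.card {d // W.out d} + 1 + 2 + Nat.card {v // T.IsBoundary v} =
      3 * Nat.card V := by
    have := Finset.sum_congr (s₁ := Finset.univ) rfl fun v _ => hdeg v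
    rw [Finset.sum_add_distrib, Finset.sum_add_distrib, Finset.sum_add_distrib, ← Nat.card_sigma,
      Nat.card_congr (Equiv.sigmaFiberEquiv _), Finset.sum_ite_eq' , Finset.sum_ite_eq',
      Finset.sum_boole, Finset.sum_const, smul_eq_mul] at this
    simp only [Finset.mem_univ, if_true, Nat.cast_id, Finset.card_univ] at this
    rw [Nat.card_eq_fintype_card (α := {v // T.IsBoundary v}), Fintype.card_subtype,
      Nat.card_eq_fintype_card (α := V), this, mul_comm]
  have hfaces : 2 * Nat.card {d // W.out d} + 3 = 3 * Nat.card T.Face + (m + 2) := by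
    have hlen : ∀ F, T.faceLength F + (if F = T.exterior then 3 else 0) =
        3 + if F = T.exterior then m + 2 else 0 := by
      intro F
      by_cases hF : F = T.exterior
      · subst hF
        have : T.faceLength T.exterior = m + 2 := T.exterior_length
        simp only [this, if_true]; omega
      · simp [hF, T.triangle F hF]
    have := Finset.sum_congr (s₁ := Finset.univ) rfl fun F _ => hlen F
    simp only [PlaneGraph.faceLength] at this
    rw [Finset.sum_add_distrib, Finset.sum_add_distrib, ← Nat.card_sigma,
      Nat.card_congr (Equiv.sigmaFiberEquiv _), Finset.sum_ite_eq', Finset.sum_ite_eq',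
      Finset.sum_const, smul_eq_mul, PlaneGraph.card_dart W.out_symm] at this
    simp only [Finset.mem_univ, if_true, Finset.card_univ] at this
    rw [Nat.card_eq_fintype_card (α := T.Face), this, mul_comm]
  have heuler : Nat.card V + Nat.card T.Face = Nat.card T.graph.edgeSet + 2 := T.planar.2
  rw [← PlaneGraph.card_out W.out_symm] at heuler
  -- With E edges and B boundary vertices, E = 3V - 3 - B from out-degrees and 2E = 3(F - 1) + m + 2
  -- from face lengths; Euler then gives B = m + 2. There are as many boundary vertices as exterior
  -- darts, so the surjection from darts to tails is injective.
  have hB : Nat.card {v // T.IsBoundary v} = m + 2 := by omega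
  have hE : Nat.card {d // T.leftFace d = T.exterior} = m + 2 := T.exterior_length
  let φ : {d // T.leftFace d = T.exterior} → {v // T.IsBoundary v} := fun d => ⟨d.1.fst, d.1, d.2, rfl⟩
  have hφ : Function.Surjective φ := by
    rintro ⟨v, d, hd, rfl⟩
    exact ⟨⟨d, hd⟩, rfl⟩
  have hbij := (Nat.bijective_iff_surjective_and_card φ).2 ⟨hφ, hE.trans hB.symm⟩
  exact Subtype.ext_iff.1 (hbij.1 (a₁ := ⟨d, hd⟩) (a₂ := ⟨d', hd'⟩) (Subtype.ext ht))

end ColouredOrientation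

end PolygonTriangulation

/-! ### The triangulation with an apex in the exterior face -/

namespace PolygonTriangulation

variable {V : Type*} [Finite V] {n m : ℕ} (T : PolygonTriangulation V n m)

/-- The darts with the exterior face on their left. -/
abbrev ExtDart := {d : T.graph.Dart // T.leftFace d = T.exterior}

/-- The darts of the triangulation, together with an edge from the tail of each exterior dart to an
apex in the exterior face, in both directions. -/
abbrev ApexDart := T.graph.Dart ⊕ (T.ExtDart ⊕ T.ExtDart)

/-- The next dart on the boundary of the exterior face. -/
def extNext : Equiv.Perm T.ExtDart := T.faceNext.subtypePerm fun d => by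
  rw [T.leftFace_faceNext]

lemma rot_faceNext (d : T.graph.Dart) : T.rot (T.faceNext d) = d.symm :=
  Equiv.apply_symm_apply _ _

lemma extNext_transitive (e e' : T.ExtDart) : ∃ k : ℕ, (T.extNext ^ k) e = e' := by
  obtain ⟨k, -, hk⟩ := (T.sameCycle_of_leftFace_eq (e.2.trans e'.2.symm)).exists_pow_eq'
  refine ⟨k, Subtype.ext ?_⟩
  rw [← hk, extNext, Equiv.Perm.subtypePerm_pow]
  rfl

open Classical in
/-- The rotation of the triangulation with an apex. -/
noncomputable def apexRot : Equiv.Perm T.ApexDart where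
  toFun
    | .inl d => if h : T.leftFace d = T.exterior then .inr (.inl ⟨d, h⟩) else .inl (T.rot d)
    | .inr (.inl e) => .inl (T.rot e.1)
    | .inr (.inr e) => .inr (.inr (T.extNext e))
  invFun
    | .inl d => if h : T.leftFace (T.rot.symm d) = T.exterior then .inr (.inl ⟨T.rot.symm d, h⟩)
        else .inl (T.rot.symm d)
    | .inr (.inl e) => .inl e.1
    | .inr (.inr e) => .inr (.inr (T.extNext.symm e))
  left_inv := by
    rintro (d | e | e)
    · by_cases h : T.leftFace d = T.exterior <;> simp [h]
    · simp [e.2]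
    · simp
  right_inv := by
    rintro (d | e | e)
    · by_cases h : T.leftFace (T.rot.symm d) = T.exterior <;> simp [h]
    · simp [e.2]
    · simp

lemma apexRot_of_exterior (e : T.ExtDart) : T.apexRot (.inl e.1) = .inr (.inl e) := by
  simp [apexRot, e.2]

lemma apexRot_of_interior {d : T.graph.Dart} (h : T.leftFace d ≠ T.exterior) :
    T.apexRot (.inl d) = .inl (T.rot d) := by
  simp [apexRot, h]

lemma apexRot_spoke (e : T.ExtDart) : T.apexRot (.inr (.inl e)) = .inl (T.rot e.1) := rfl

lemma apexRot_back (e : T.ExtDart) : T.apexRot (.inr (.inr e)) = .inr (.inr (T.extNext e)) := rfl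

/-- The tail of a dart of the triangulation with an apex. -/
def apexTail : T.ApexDart → Option V
  | .inl d => some d.fst
  | .inr (.inl e) => some e.1.fst
  | .inr (.inr _) => none

/-- The reversal of a dart of the triangulation with an apex. -/
def apexRev : T.ApexDart → T.ApexDart
  | .inl d => .inl d.symm
  | .inr (.inl e) => .inr (.inr e)
  | .inr (.inr e) => .inr (.inl e)

lemma sameCycle_inl (d d' : T.graph.Dart) (h : d.fst = d'.fst) :
    T.apexRot.SameCycle (.inl d) (.inl d') := by
  obtain ⟨k, -, rfl⟩ := (T.rot_sameCycle d d' h).exists_pow_eq'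
  clear h
  induction k with
  | zero => exact .refl _ _
  | succ k ih =>
    refine ih.trans ?_
    rw [pow_succ', Equiv.Perm.mul_apply]
    by_cases he : T.leftFace ((T.rot ^ k) d) = T.exterior
    · rw [← T.apexRot_spoke ⟨_, he⟩, ← T.apexRot_of_exterior ⟨_, he⟩]
      exact Equiv.Perm.sameCycle_apply_right.2 (Equiv.Perm.sameCycle_apply_right.2 (.refl _ _))
    · rw [← T.apexRot_of_interior he]
      exact Equiv.Perm.sameCycle_apply_right.2 (.refl _ _)

lemma sameCycle_spoke (e : T.ExtDart) : T.apexRot.SameCycle (.inr (.inl e)) (.inl e.1) := by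
  rw [← T.apexRot_of_exterior]
  exact Equiv.Perm.sameCycle_apply_left.2 (.refl _ _)

lemma sameCycle_back (e e' : T.ExtDart) :
    T.apexRot.SameCycle (.inr (.inr e)) (.inr (.inr e')) := by
  obtain ⟨k, rfl⟩ := T.extNext_transitive e e'
  induction k with
  | zero => exact .refl _ _
  | succ k ih =>
    refine ih.trans ?_
    rw [pow_succ', Equiv.Perm.mul_apply, ← apexRot_back]
    exact Equiv.Perm.sameCycle_apply_right.2 (.refl _ _)

/-- The triangulation with an apex in the exterior face, adjacent to all boundary vertices. -/
noncomputable def apexMap : RotMap T.ApexDart (Option V) where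
  tail := T.apexTail
  rot := T.apexRot
  rev := T.apexRev
  rev_rev := by rintro (d | e | e) <;> simp [apexRev]
  tail_rot := by
    rintro (d | e | e)
    · by_cases h : T.leftFace d = T.exterior
      · rw [T.apexRot_of_exterior ⟨d, h⟩]; rfl
      · rw [T.apexRot_of_interior h]
        exact congrArg some (T.rot_fst d)
    · exact congrArg some (T.rot_fst e.1)
    · rfl
  sameCycle := by
    rintro (d | e | e) (d' | e' | e') h
    · exact T.sameCycle_inl _ _ (Option.some_injective _ h)
    · exact (T.sameCycle_inl _ _ (Option.some_injective _ h)).trans (T.sameCycle_spoke e').symm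
    · simp [apexTail] at h
    · exact (T.sameCycle_spoke e).trans (T.sameCycle_inl _ _ (Option.some_injective _ h))
    · exact ((T.sameCycle_spoke e).trans (T.sameCycle_inl _ _ (Option.some_injective _ h))).trans
        (T.sameCycle_spoke e').symm
    · simp [apexTail] at h
    · simp [apexTail] at h
    · simp [apexTail] at h
    · exact T.sameCycle_back e e'

lemma apexMap_next_eq {x y : T.ApexDart} (h : T.apexRot y = T.apexRev x) :
    T.apexMap.next x = y := (Equiv.symm_apply_eq _).2 h.symm

lemma apexMap_next_exterior (e : T.ExtDart) :
    T.apexMap.next (.inl e.1) = .inr (.inl (T.extNext e)) :=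
  T.apexMap_next_eq (congrArg Sum.inl (T.rot_faceNext e.1))

lemma apexMap_next_interior {d : T.graph.Dart} (h : T.leftFace d ≠ T.exterior) :
    T.apexMap.next (.inl d) = .inl (T.faceNext d) :=
  T.apexMap_next_eq (by
    rw [T.apexRot_of_interior (by rwa [T.leftFace_faceNext]), T.rot_faceNext]; rfl)

lemma apexMap_next_spoke (e : T.ExtDart) :
    T.apexMap.next (.inr (.inl (T.extNext e))) = .inr (.inr e) :=
  T.apexMap_next_eq rfl

lemma apexMap_next_back (e : T.ExtDart) : T.apexMap.next (.inr (.inr e)) = .inl e.1 :=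
  T.apexMap_next_eq (T.apexRot_of_exterior e)

open Classical in
/-- The face of the triangulation with an apex to the left of a dart. The faces at the apex are
indexed by their exterior darts. -/
noncomputable def apexFace : T.ApexDart → {F : T.Face // F ≠ T.exterior} ⊕ T.ExtDart
  | .inl d => if h : T.leftFace d = T.exterior then .inr ⟨d, h⟩ else .inl ⟨T.leftFace d, h⟩
  | .inr (.inl e) => .inr (T.extNext.symm e)
  | .inr (.inr e) => .inr e

lemma apexFace_exterior (e : T.ExtDart) : T.apexFace (.inl e.1) = .inr e := by
  simp [apexFace, e.2]

lemma apexFace_interior {d : T.graph.Dart} (h : T.leftFace d ≠ T.exterior) :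
    T.apexFace (.inl d) = .inl ⟨T.leftFace d, h⟩ := by
  simp [apexFace, h]

lemma apexFace_faceInv : T.apexMap.FaceInv T.apexFace := by
  rintro (d | e | e)
  · by_cases h : T.leftFace d = T.exterior
    · rw [T.apexMap_next_exterior ⟨d, h⟩, T.apexFace_exterior ⟨d, h⟩]
      simp [apexFace]
    · rw [T.apexMap_next_interior h, T.apexFace_interior h,
        T.apexFace_interior (by rwa [T.leftFace_faceNext])]
      simp only [T.leftFace_faceNext]
  · obtain ⟨e, rfl⟩ := T.extNext.surjective e
    rw [T.apexMap_next_spoke]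
    simp [apexFace]
  · rw [T.apexMap_next_back, T.apexFace_exterior]
    rfl

namespace ColouredOrientation

variable {T} (W : T.ColouredOrientation)

/-- The orientation of the triangulation with an apex, in which the new edges go to the apex. -/
def apexOut : T.ApexDart → Prop
  | .inl d => W.out d
  | .inr (.inl _) => True
  | .inr (.inr _) => False

/-- The colouring of the triangulation with an apex, in which the new edges are blue. -/
def apexCol : T.ApexDart → ZMod 3
  | .inl d => (W.col d).code
  | .inr _ => 0

lemma apexOut_rev (x : T.ApexDart) : W.apexOut (T.apexRev x) ↔ ¬ W.apexOut x := by
  rcases x with d | e | e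
  · exact W.out_symm d
  · simp [apexRev, apexOut]
  · simp [apexRev, apexOut]

/-- With k exterior darts, the apex adds one vertex and k edges and replaces the exterior face by k
faces, so Euler's formula persists. -/
theorem apexMap_exact (W : T.ColouredOrientation) [Fintype T.ApexDart] : T.apexMap.Exact := by
  classical
  have := Fintype.ofFinite V
  have := Fintype.ofFinite T.Face
  have := Fintype.ofFinite T.ExtDart
  refine RotMap.exact_of_euler W.apexOut W.apexOut_rev T.apexFace T.apexFace_faceInv ?_ ?_ ?_
  · have hout : Nat.card {x // W.apexOut x} = Nat.card {d // W.out d} + Nat.card T.ExtDart := by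
      rw [← Nat.card_sum]
      refine Nat.card_congr ⟨fun x => match x with
          | ⟨.inl d, h⟩ => .inl ⟨d, h⟩
          | ⟨.inr (.inl e), _⟩ => .inr e
          | ⟨.inr (.inr _), h⟩ => h.elim,
        fun x => match x with
          | .inl d => ⟨.inl d.1, d.2⟩
          | .inr e => ⟨.inr (.inl e), trivial⟩, ?_, ?_⟩
      · rintro ⟨d | e | e, h⟩
        · rfl
        · rfl
        · exact h.elim
      · rintro (d | e) <;> rfl
    have hface : Nat.card T.Face = Nat.card {F : T.Face // F ≠ T.exterior} + 1 := by
      rw [Nat.card_congr (Equiv.sumCompl fun F => F = T.exterior).symm, Nat.card_sum, add_comm]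
      congr 1
      simp
    have heuler : Nat.card V + Nat.card T.Face = Nat.card T.graph.edgeSet + 2 := T.planar.2
    rw [← PlaneGraph.card_out W.out_symm] at heuler
    rw [hout, Fintype.card_option, Fintype.card_sum, ← Nat.card_eq_fintype_card,
      ← Nat.card_eq_fintype_card, ← Nat.card_eq_fintype_card]
    omega
  · intro h hh
    have h1 : ∀ u v, h (some u) = h (some v) :=
      T.planar.const_of_adj (h := fun v => h (some v)) fun d => hh (.inl d)
    have h2 : h (some T.vy) = h none := hh (.inr (.inl ⟨T.root.symm, rfl⟩))
    have h3 : ∀ u, h u = h none := by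
      rintro (_ | u)
      · rfl
      · rw [h1 u T.vy, h2]
    intro u v
    rw [h3 u, h3 v]
  · intro f hf
    have h1 : ∀ e, f (.inr (T.extNext e)) = f (.inr e) := fun e => by
      have := hf (.inr (.inr (T.extNext e)))
      simpa [apexFace, apexMap, apexRev] using this
    have h2 : ∀ e e', f (.inr e) = f (.inr e') := by
      intro e e'
      obtain ⟨k, rfl⟩ := T.extNext_transitive e e'
      induction k with
      | zero => rfl
      | succ k ih => rw [pow_succ', Equiv.Perm.mul_apply, h1, ih]
    let e0 : T.ExtDart := ⟨T.root.symm, rfl⟩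
    let F : T.Face → ℚ := fun a => if h : a = T.exterior then f (.inr e0) else f (.inl ⟨a, h⟩)
    have hF : ∀ d, F (T.leftFace d) = f (T.apexFace (.inl d)) := by
      intro d
      by_cases h : T.leftFace d = T.exterior
      · rw [T.apexFace_exterior ⟨d, h⟩]
        simp only [F, h, dif_pos]
        exact h2 _ _
      · rw [T.apexFace_interior h]
        simp only [F, h, dif_neg, not_false_eq_true]
    have h3 : ∀ d d', f (T.apexFace (.inl d)) = f (T.apexFace (.inl d')) := by
      intro d d'
      rw [← hF, ← hF]
      refine T.planar.const_of_faces (f := fun d => F (T.leftFace d))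
        (fun d => congrArg F (T.leftFace_faceNext d)) (fun d => ?_) d d'
      rw [hF, hF]
      exact hf (.inl d)
    have h4 : ∀ a, ∃ d, T.apexFace (.inl d) = a := by
      rintro (⟨a, ha⟩ | e)
      · obtain ⟨d, rfl⟩ := T.leftFace_surjective a
        exact ⟨d, T.apexFace_interior ha⟩
      · exact ⟨e.1, T.apexFace_exterior e⟩
    intro a b
    obtain ⟨d, rfl⟩ := h4 a
    obtain ⟨d', rfl⟩ := h4 b
    exact h3 d d'

variable {W} in
-- No edge leaves the apex, so membership in `A` passes from each face at the apex to its
-- predecessor along the exterior boundary. One of these faces, that of the root edge, is not in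
-- `A`, hence none is; what remains is a region of the original triangulation.
theorem IsMaximal.apex_eq_empty (hW : W.IsMaximal) {A : Set T.ApexDart}
    (hA : ∀ x, T.apexMap.next x ∈ A ↔ x ∈ A) (hext : Sum.inl T.root.symm ∉ A)
    (hb : ∀ x ∈ A, T.apexRev x ∉ A → W.apexOut x) : A = ∅ := by
  have hback : ∀ e : T.ExtDart, Sum.inl e.1 ∈ A ↔ Sum.inr (Sum.inr e) ∈ A := fun e => by
    rw [← hA (.inr (.inr e)), T.apexMap_next_back]
  have hspoke : ∀ e : T.ExtDart, Sum.inr (Sum.inl (T.extNext e)) ∈ A ↔ Sum.inr (Sum.inr e) ∈ A :=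
    fun e => by rw [← hA (.inr (.inl _)), T.apexMap_next_spoke]
  have hstep : ∀ e : T.ExtDart, Sum.inr (Sum.inr (T.extNext e)) ∈ A → Sum.inr (Sum.inr e) ∈ A := by
    intro e he
    rw [← hspoke]
    by_contra h
    exact hb _ he h
  have hno : ∀ e : T.ExtDart, Sum.inl e.1 ∉ A := by
    intro e he
    obtain ⟨k, rfl⟩ := T.extNext_transitive ⟨T.root.symm, rfl⟩ e
    rw [hback] at he
    refine hext ((hback ⟨T.root.symm, rfl⟩).2 ?_)
    induction k with
    | zero => exact he
    | succ k ih =>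
      rw [pow_succ', Equiv.Perm.mul_apply] at he
      exact ih (hstep _ he)
  have hbase : {d : T.graph.Dart | Sum.inl d ∈ A} = ∅ := by
    refine hW.eq_empty (fun d => ?_) hext fun d hd => ?_
    · by_cases h : T.leftFace d = T.exterior
      · have h' : T.leftFace (T.faceNext d) = T.exterior := (T.leftFace_faceNext d).trans h
        exact iff_of_false (hno ⟨_, h'⟩) (hno ⟨d, h⟩)
      · have := hA (.inl d)
        rwa [T.apexMap_next_interior h] at this
    · exact hb (.inl d) hd.1 hd.2
  have hbackno : ∀ e : T.ExtDart, Sum.inr (Sum.inr e) ∉ A := fun e he => hno e ((hback e).2 he)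
  ext x
  simp only [Set.mem_empty_iff_false, iff_false]
  rcases x with d | e | e
  · exact fun h => Set.notMem_empty d (hbase ▸ h)
  · obtain ⟨e, rfl⟩ := T.extNext.surjective e
    rw [hspoke]
    exact hbackno e
  · exact hbackno e

end ColouredOrientation

end PolygonTriangulation

/-! ### The maximal wood extended to the apex -/

namespace PolygonTriangulation

variable {V : Type*} [Finite V] {n m : ℕ} (T : PolygonTriangulation V n m)

/-- The three roots of the triangulation with an apex. -/
def apexRoot (c : ZMod 3) : Option V :=
  if c = 0 then none else if c = 1 then some T.vr else some T.vy

lemma apexRoot_zero : T.apexRoot 0 = none := rfl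

lemma apexRoot_one : T.apexRoot 1 = some T.vr := rfl

lemma apexRoot_two : T.apexRoot 2 = some T.vy := rfl

lemma forall_ne_apexRoot {u : Option V} :
    (∀ k, u ≠ T.apexRoot k) ↔ ∃ v, u = some v ∧ v ≠ T.vr ∧ v ≠ T.vy := by
  have h3 : ∀ k : ZMod 3, k = 0 ∨ k = 1 ∨ k = 2 := by decide
  constructor
  · intro h
    rcases u with _ | v
    · exact absurd rfl (h 0)
    · exact ⟨v, rfl, fun h' => h 1 (by rw [h', apexRoot_one]), fun h' => h 2 (by rw [h', apexRoot_two])⟩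
  · rintro ⟨v, rfl, h1, h2⟩ k h
    rcases h3 k with rfl | rfl | rfl
    · rw [apexRoot_zero] at h; exact Option.some_ne_none _ h
    · exact h1 (Option.some_injective _ h)
    · exact h2 (Option.some_injective _ h)

namespace ColouredOrientation

variable {T} {W : T.ColouredOrientation}

lemma IsSchnyderWood.apex_exists_out (hW : W.IsSchnyderWood) {v : V} (hr : v ≠ T.vr)
    (hy : v ≠ T.vy) (c : ZMod 3) :
    ∃ x, T.apexTail x = some v ∧ W.apexOut x ∧ W.apexCol x = c := by
  obtain ⟨c, rfl⟩ := SWColour.code_surjective c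
  by_cases hb : T.IsBoundary v
  · have h := hW.2.1 v hb hr hy
    cases c with
    | blue =>
      obtain ⟨d, hd, rfl⟩ := hb
      exact ⟨.inr (.inl ⟨d, hd⟩), rfl, trivial, rfl⟩
    | red =>
      obtain ⟨d, ⟨rfl, h2, h3⟩, -⟩ := h.1
      exact ⟨.inl d, rfl, h2, congrArg SWColour.code h3⟩
    | yellow =>
      obtain ⟨d, ⟨rfl, h2, h3⟩, -⟩ := h.2.1
      exact ⟨.inl d, rfl, h2, congrArg SWColour.code h3⟩
  · obtain ⟨d, ⟨rfl, h2, h3⟩, -⟩ := (hW.1 v hb).1 c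
    exact ⟨.inl d, rfl, h2, congrArg SWColour.code h3⟩

lemma IsSchnyderWood.apex_unique (hW : W.IsSchnyderWood) {v : V} (hr : v ≠ T.vr)
    (hy : v ≠ T.vy) {x y : T.ApexDart} (hx : T.apexTail x = some v) (hy' : T.apexTail y = some v)
    (hxo : W.apexOut x) (hyo : W.apexOut y) (hc : W.apexCol x = W.apexCol y) : x = y := by
  have hne : ∀ (d : T.graph.Dart) (e : T.ExtDart), d.fst = v → e.1.fst = v → W.out d →
      (W.col d).code ≠ 0 := by
    intro d e h1 h2 h3 h4
    exact (hW.2.1 v ⟨e.1, e.2, h2⟩ hr hy).2.2.1 d h1 h3 (SWColour.code_injective (h4.trans rfl))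
  rcases x with d | e | e <;> rcases y with d' | e' | e'
  · have h1 : d.fst = v := Option.some_injective _ hx
    have h2 : d'.fst = v := Option.some_injective _ hy'
    have h3 : W.col d = W.col d' := SWColour.code_injective hc
    congr 1
    by_cases hb : T.IsBoundary v
    · exact (hW.2.1 v hb hr hy).unique h1 h2 hxo hyo h3
    · obtain ⟨e, -, he⟩ := (hW.1 v hb).1 (W.col d)
      exact (he d ⟨h1, hxo, rfl⟩).trans (he d' ⟨h2, hyo, h3.symm⟩).symm
  · exact absurd hc (hne d e' (Option.some_injective _ hx) (Option.some_injective _ hy') hxo)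
  · exact hyo.elim
  · exact absurd hc.symm (hne d' e (Option.some_injective _ hy') (Option.some_injective _ hx) hyo)
  · congr 2
    exact Subtype.ext (hW.exterior_unique e.2 e'.2
      (Option.some_injective _ (hx.trans hy'.symm)))
  · exact hyo.elim
  · exact hxo.elim
  · exact hxo.elim
  · exact hxo.elim

open Classical in
lemma IsSchnyderWood.apex_monotone (hW : W.IsSchnyderWood) {v : V} (hr : v ≠ T.vr)
    (hy : v ≠ T.vy) {x : T.ApexDart} (hx : T.apexTail x = some v)
    (hne : ¬ (W.apexOut (T.apexRot x) ∧ W.apexCol (T.apexRot x) = 0)) :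
    patternRank (decide (W.apexOut x)) (W.apexCol x) ≤
      patternRank (decide (W.apexOut (T.apexRot x))) (W.apexCol (T.apexRot x)) := by
  rcases x with d | e | e
  · by_cases he : T.leftFace d = T.exterior
    · rw [T.apexRot_of_exterior ⟨d, he⟩] at hne
      exact absurd ⟨trivial, rfl⟩ hne
    · have hd : d.fst = v := Option.some_injective _ hx
      rw [T.apexRot_of_interior he] at hne ⊢
      change patternRank (decide (W.out d)) (W.col d).code ≤
        patternRank (decide (W.out (T.rot d))) (W.col (T.rot d)).code
      rw [← W.rank_eq, ← W.rank_eq]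
      by_cases hb : T.IsBoundary v
      · exact (hW.2.1 v hb hr hy).2.2.2 d hd he
      · exact (hW.1 v hb).2 d hd fun h => hne ⟨h.1, congrArg SWColour.code h.2⟩
  · have : patternRank (decide (W.apexOut (.inr (.inl e)))) (W.apexCol (.inr (.inl e))) = 0 := by
      rw [patternRank, if_pos (decide_eq_true (show W.apexOut (.inr (.inl e)) from trivial))]
      rfl
    rw [this]
    exact Nat.zero_le _
  · exact absurd hx.symm (Option.some_ne_none _)

lemma IsSchnyderWood.apex_succ (hW : W.IsSchnyderWood) {x : T.ApexDart}
    (hx : ∀ k, T.apexTail x ≠ T.apexRoot k) :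
    (W.apexOut x ∧ ((W.apexOut (T.apexRot x) ∧ W.apexCol (T.apexRot x) = W.apexCol x + 1) ∨
      (¬ W.apexOut (T.apexRot x) ∧ W.apexCol (T.apexRot x) = W.apexCol x - 1))) ∨
    (¬ W.apexOut x ∧ ((¬ W.apexOut (T.apexRot x) ∧ W.apexCol (T.apexRot x) = W.apexCol x) ∨
      (W.apexOut (T.apexRot x) ∧ W.apexCol (T.apexRot x) = W.apexCol x - 1))) := by
  obtain ⟨v, hv, hr, hy⟩ := T.forall_ne_apexRoot.1 hx
  exact RotMap.succ_of_monotone (M := T.apexMap) (hW.apex_exists_out hr hy)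
    (fun x y hx hy' => hW.apex_unique hr hy hx hy') (fun x hx => hW.apex_monotone hr hy hx) hv

/-- A maximal Schnyder wood, extended to the triangulation with an apex. -/
noncomputable def IsMaximal.schnyderMap [Fintype T.ApexDart] (hW : W.IsMaximal) :
    SchnyderMap T.ApexDart (Option V) where
  toRotMap := T.apexMap
  out := W.apexOut
  out_rev := W.apexOut_rev
  col := W.apexCol
  col_rev := by
    rintro (d | e | e)
    · exact congrArg SWColour.code (W.col_symm d)
    · rfl
    · rfl
  root := T.apexRoot
  -- The new triangle on the root edge meets all three roots: its darts start at `vy`, `vr` and the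
  -- apex in turn.
  ext := .inl T.root.symm
  exists_ext := by
    have h3 : ∀ k : ZMod 3, k = 0 ∨ k = 1 ∨ k = 2 := by decide
    have h1 := T.apexMap_next_exterior ⟨T.root.symm, rfl⟩
    have h2 := T.apexMap_next_spoke ⟨T.root.symm, rfl⟩
    intro c
    rcases h3 c with rfl | rfl | rfl
    · refine ⟨2, ?_⟩
      rw [Function.iterate_succ_apply, Function.iterate_succ_apply, h1, h2]
      rfl
    · refine ⟨1, ?_⟩
      rw [Function.iterate_succ_apply, h1]
      exact congrArg some (T.rotMap.tail_next T.root.symm)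
    · exact ⟨0, rfl⟩
  exists_out := by
    intro u hu c
    obtain ⟨v, rfl, hr, hy⟩ := T.forall_ne_apexRoot.1 hu
    exact hW.1.apex_exists_out hr hy c
  out_unique := by
    intro x y hx ht hxo hyo hc
    obtain ⟨v, hv, hr, hy⟩ := T.forall_ne_apexRoot.1 hx
    exact hW.1.apex_unique hr hy hv (ht.symm.trans hv) hxo hyo hc
  rot_out := fun x hx ho => by
    rcases hW.1.apex_succ hx with h | h
    · exact h.2
    · exact absurd ho h.1
  rot_in := fun x hx ho => by
    rcases hW.1.apex_succ hx with h | h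
    · exact absurd h.1 ho
    · exact h.2
  root_col := by
    have h3 : ∀ k : ZMod 3, k = 0 ∨ k = 1 ∨ k = 2 := by decide
    intro x c hx ho hc
    rcases x with d | e | e
    · rcases h3 c with rfl | rfl | rfl
      · exact absurd hc (Option.some_ne_none _)
      · exact congrArg SWColour.code (hW.1.2.2.2.2.1 d (Option.some_injective _ hc) ho)
      · exact congrArg SWColour.code (hW.1.2.2.2.2.2 d (Option.some_injective _ hc) ho)
    · rcases h3 c with rfl | rfl | rfl
      · rfl
      · exact absurd hc.symm (Option.some_ne_none _)
      · exact absurd hc.symm (Option.some_ne_none _)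
    · exact ho.elim
  exact := W.apexMap_exact
  noccw := fun _ hA hext hb => hW.apex_eq_empty hA hext hb

lemma IsMaximal.edge_ne_root (hW : W.IsMaximal) {c : SWColour} {u v : V} (h : W.Edge c u v) :
    u ≠ T.vy ∧ (c ≠ .yellow → u ≠ T.vr) ∧ (u = T.vr → v = T.vy) ∧ (v = T.vr → c = .red) ∧
      (v = T.vy → c = .yellow) := by
  obtain ⟨d, rfl, rfl, ho, rfl⟩ := h
  have hroot : d.fst = T.vr → d = T.root := fun h => by
    obtain ⟨e, -, he⟩ := hW.1.2.2.1
    exact (he d ⟨h, ho⟩).trans (he T.root ⟨rfl, hW.1.root_yellow.1⟩).symm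
  refine ⟨fun h => hW.1.2.2.2.1 d h ho, fun hc h => hc ?_, fun h => ?_, fun h => ?_, fun h => ?_⟩
  · rw [hroot h]; exact hW.1.root_yellow.2
  · rw [hroot h]; rfl
  · exact hW.1.2.2.2.2.1 d h ho
  · exact hW.1.2.2.2.2.2 d h ho

lemma IsMaximal.not_edge_symm {c c' : SWColour} {u v : V} (h : W.Edge c u v)
    (h' : W.Edge c' v u) : False := by
  obtain ⟨d, rfl, rfl, ho, -⟩ := h
  obtain ⟨d', h1, h2, ho', -⟩ := h'
  have : d' = d.symm := SimpleGraph.Dart.ext _ _ (Prod.ext h1 h2)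
  rw [this] at ho'
  exact (W.out_symm d).1 ho' ho

lemma IsSchnyderWood.exists_edge (hW : W.IsSchnyderWood) {v : V} (hr : v ≠ T.vr) (hy : v ≠ T.vy)
    {c : SWColour} (hc : T.IsBoundary v → c ≠ .blue) : ∃ x, W.Edge c v x := by
  by_cases hb : T.IsBoundary v
  · have h := hW.2.1 v hb hr hy
    cases c with
    | blue => exact absurd rfl (hc hb)
    | red =>
      obtain ⟨d, ⟨h1, h2, h3⟩, -⟩ := h.1
      exact ⟨d.snd, d, h1, rfl, h2, h3⟩
    | yellow =>
      obtain ⟨d, ⟨h1, h2, h3⟩, -⟩ := h.2.1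
      exact ⟨d.snd, d, h1, rfl, h2, h3⟩
  · obtain ⟨d, ⟨h1, h2, h3⟩, -⟩ := (hW.1 v hb).1 c
    exact ⟨d.snd, d, h1, rfl, h2, h3⟩

/-! ### Induction along the coloured paths -/

section Paths

variable [Fintype T.ApexDart] (hW : W.IsMaximal)

lemma mem_edges_inl {c : SWColour} {d : T.graph.Dart} :
    Sum.inl d ∈ hW.schnyderMap.edges c.code ↔
      W.out d ∧ W.col d = c ∧ d.fst ≠ T.vr ∧ d.fst ≠ T.vy := by
  have h : (∀ k, some d.fst ≠ T.apexRoot k) ↔ d.fst ≠ T.vr ∧ d.fst ≠ T.vy := by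
    rw [T.forall_ne_apexRoot]
    constructor
    · rintro ⟨v, hv, h⟩
      rwa [Option.some_injective _ hv]
    · exact fun h => ⟨_, rfl, h⟩
  exact and_congr_right fun _ => and_congr (SWColour.code_injective.eq_iff) h

lemma reach_subset_path {c : SWColour} {v : V} {u : Option V}
    (h : hW.schnyderMap.Reach c.code (some v) u) : ∀ w, u = some w → w ∈ W.path c v := by
  induction h with
  | refl =>
    intro w hw
    rw [← Option.some_injective _ hw]
    exact ReflTransGen.refl
  | tail _ hs ih =>
    intro w hw
    obtain ⟨x, hx, rfl, rfl⟩ := hs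
    rcases x with d | e | e
    · have hd := (mem_edges_inl hW).1 hx
      have := ih d.fst rfl
      exact ReflTransGen.tail this ⟨d, rfl, Option.some_injective _ hw, hd.1, hd.2.1⟩
    · exact absurd hw.symm (Option.some_ne_none _)
    · exact hx.1.elim

lemma IsMaximal.reach_of_edge (hW : W.IsMaximal) {c c' : SWColour} (hc : c'.code = c.code + 1)
    {w w' z : V} (h : W.Edge c w w') (h' : W.Edge c' w' z) (hw : w ≠ T.vr) (hw' : w' ≠ T.vr) :
    hW.schnyderMap.Reach c'.code (some w) (some z) := by
  have hwy := (hW.edge_ne_root h).1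
  have hwy' := (hW.edge_ne_root h').1
  obtain ⟨d, rfl, rfl, ho, hcol⟩ := h
  obtain ⟨d', ht, rfl, ho', hcol'⟩ := h'
  have he := (mem_edges_inl hW).2 ⟨ho, hcol, hw, hwy⟩
  have he' := (mem_edges_inl hW).2 ⟨ho', hcol', ht ▸ hw', ht ▸ hwy'⟩
  rw [hc] at he' ⊢
  exact SchnyderMap.reach_of_edges he he' (congrArg some ht)

/-- One step of the induction along the path of colour `c`. -/
lemma IsMaximal.path_step (hW : W.IsMaximal) {c c' : SWColour} (hc : c'.code = c.code + 1)
    {v w w' x z : V} (h : W.Edge c w w') (h' : W.Edge c' w' z) (hw : w ≠ T.vr) (hw' : w' ≠ T.vr)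
    (hx : W.Edge c' w x) (hxv : x ∈ W.path c' v) : z ∈ W.path c' v := by
  have hr := hW.reach_of_edge hc h h' hw hw'
  -- As `z` differs from `w`, the path from `w` to `z` passes through the first out-neighbour `x`,
  -- which is already on the path from `v`.
  have hzw : some w ≠ some z := fun he => by
    rw [Option.some_injective _ he] at h
    exact IsMaximal.not_edge_symm h h'
  have hwy := (hW.edge_ne_root h).1
  obtain ⟨d, rfl, rfl, ho, hcol⟩ := hx
  have := hr.head_of_ne hzw ⟨.inl d, (mem_edges_inl hW).2 ⟨ho, hcol, hw, hwy⟩, rfl, rfl⟩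
  exact ReflTransGen.trans hxv (reach_subset_path hW this _ rfl)

include hW in
lemma red_of_mem_path_blue {v : V} (hr : v ≠ T.vr) (hy : v ≠ T.vy) :
    ∀ w ∈ W.path .blue v, ∃ x ∈ W.path .red v, W.Edge .red w x := by
  intro w hw
  induction hw with
  | refl =>
    obtain ⟨x, hx⟩ := hW.1.exists_edge hr hy (c := .red) (fun _ => by simp)
    exact ⟨x, .single hx, hx⟩
  | tail _ hs ih =>
    obtain ⟨x, hxv, hx⟩ := ih
    obtain ⟨-, h2, -, h4, h5⟩ := hW.edge_ne_root hs
    have hr' : _ ≠ T.vr := fun h => SWColour.noConfusion (h4 h)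
    obtain ⟨z, hz⟩ := hW.1.exists_edge hr' (fun h => SWColour.noConfusion (h5 h)) (c := .red)
      (fun _ => by simp)
    exact ⟨z, hW.path_step (by decide) hs hz (h2 (by simp)) hr' hx hxv, hz⟩

include hW in
lemma vy_mem_path_yellow {v : V} (hy : v ≠ T.vy) : T.vy ∈ W.path .yellow v := by
  by_cases hr : v = T.vr
  · rw [hr]
    exact ReflTransGen.single ⟨T.root, rfl, rfl, hW.1.root_yellow⟩
  · exact reach_subset_path hW (c := .yellow) (SchnyderMap.reach_root (M := hW.schnyderMap)
      (T.forall_ne_apexRoot.2 ⟨v, rfl, hr, hy⟩) 2) _ rfl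

include hW in
lemma yellow_of_mem_path_red {v : V} (hy : v ≠ T.vy) :
    ∀ w ∈ W.path .red v, ∃ x ∈ W.path .yellow v, W.Edge .yellow w x := by
  intro w hw
  -- The root edge leaves a root and is not in `edges`, so `vr` needs separate treatment; every
  -- yellow path ends at `vy`, the yellow out-neighbour of `vr`.
  have hroot : ∃ x ∈ W.path .yellow v, W.Edge .yellow T.vr x :=
    ⟨T.vy, vy_mem_path_yellow hW hy, T.root, rfl, rfl, hW.1.root_yellow⟩
  induction hw with
  | refl =>
    by_cases hr : v = T.vr
    · rwa [hr] at hroot ⊢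
    · obtain ⟨x, hx⟩ := hW.1.exists_edge hr hy (c := .yellow) (fun _ => by simp)
      exact ⟨x, .single hx, hx⟩
  | @tail _ w' _ hs ih =>
    by_cases hr' : w' = T.vr
    · rwa [hr']
    obtain ⟨x, hxv, hx⟩ := ih
    obtain ⟨-, h2, -, -, h5⟩ := hW.edge_ne_root hs
    obtain ⟨z, hz⟩ := hW.1.exists_edge hr' (fun h => SWColour.noConfusion (h5 h)) (c := .yellow)
      (fun _ => by simp)
    exact ⟨z, hW.path_step (by decide) hs hz (h2 (by simp)) hr' hx hxv, hz⟩

/-- The blue edge of a boundary vertex goes straight to the apex, where the path stops. -/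
lemma eq_of_reach_boundary {w z : V} (hw : T.IsBoundary w) (hr : w ≠ T.vr) (hy : w ≠ T.vy)
    (h : hW.schnyderMap.Reach 0 (some w) (some z)) : w = z := by
  by_contra hne
  obtain ⟨d, hd, rfl⟩ := hw
  have hmem : (.inr (.inl ⟨d, hd⟩) : T.ApexDart) ∈ hW.schnyderMap.edges 0 :=
    ⟨trivial, rfl, T.forall_ne_apexRoot.2 ⟨_, rfl, hr, hy⟩⟩
  have h' := h.head_of_ne (fun h => hne (Option.some_injective _ h)) ⟨_, hmem, rfl, rfl⟩
  rcases ReflTransGen.cases_head h' with h | ⟨_, ⟨x, hx, hxt, -⟩, -⟩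
  · exact Option.some_ne_none _ h.symm
  · exact hx.2.2 0 hxt

include hW in
lemma blue_of_mem_path_yellow {v : V} :
    ∀ w ∈ W.path .yellow v, T.IsBoundary w ∨ ∃ x ∈ W.path .blue v, W.Edge .blue w x := by
  have hinterior : ∀ w, ¬ T.IsBoundary w → w ≠ T.vr ∧ w ≠ T.vy := fun w hw =>
    ⟨fun h => hw (h ▸ T.isBoundary_vr), fun h => hw (h ▸ T.isBoundary_vy)⟩
  intro w hw
  induction hw with
  | refl =>
    by_cases hb : T.IsBoundary v
    · exact .inl hb
    · obtain ⟨x, hx⟩ := hW.1.exists_edge (hinterior v hb).1 (hinterior v hb).2 (c := .blue)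
        (fun h => absurd h hb)
      exact .inr ⟨x, .single hx, hx⟩
  | @tail w w' _ hs ih =>
    by_cases hb' : T.IsBoundary w'
    · exact .inl hb'
    right
    obtain ⟨hr', hy'⟩ := hinterior w' hb'
    obtain ⟨hy, -, h3, -, -⟩ := hW.edge_ne_root hs
    have hr : w ≠ T.vr := fun h => hy' (h3 h)
    obtain ⟨z, hz⟩ := hW.1.exists_edge hr' hy' (c := .blue) (fun h => absurd h hb')
    rcases ih with hb | ⟨x, hxv, hx⟩
    -- A yellow path cannot return from the boundary to the interior: the blue out-neighbour of `w'`
    -- would lie on the blue path of the boundary vertex `w`, hence be `w` itself, giving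
    -- antiparallel edges.
    · have := eq_of_reach_boundary hW hb hr hy
        (hW.reach_of_edge (c' := .blue) (by decide) hs hz hr hr')
      rw [this] at hs
      exact (IsMaximal.not_edge_symm hs hz).elim
    · exact ⟨z, hW.path_step (by decide) hs hz hr hr' hx hxv, hz⟩

end Paths

end ColouredOrientation

end PolygonTriangulation

theorem theorem2p12 {V : Type*} [Finite V] (n m : ℕ) (T : PolygonTriangulation V n m)
    (W : T.ColouredOrientation) (hW : W.IsMaximal) (v : V) :
    (v ≠ T.vr → v ≠ T.vy → ∀ w ∈ W.path .blue v, ∃ x ∈ W.path .red v, W.Edge .red w x) ∧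
    (v ≠ T.vy → ∀ w ∈ W.path .red v, ∃ x ∈ W.path .yellow v, W.Edge .yellow w x) ∧
    (∀ w ∈ W.path .yellow v, T.IsBoundary w ∨ ∃ x ∈ W.path .blue v, W.Edge .blue w x) := by
  have := Fintype.ofFinite T.ApexDart
  exact ⟨PolygonTriangulation.ColouredOrientation.red_of_mem_path_blue hW,
    PolygonTriangulation.ColouredOrientation.yellow_of_mem_path_red hW,
    PolygonTriangulation.ColouredOrientation.blue_of_mem_path_yellow hW⟩
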